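/- Let $d\ge 1$, let $B^d$ be the closed unit ball of $\mathbb R^d$ and $\kappa_d$ its volume. Let $X_1,X_2,\dots$ be independent random points, each uniformly distributed in $B^d$. For $n\ge 0$ let $P_n$ be the convex hull of $X_1,\dots,X_n$ and $f_{d-1}(P_n)$ the number of its nonempty $(d-1)$-dimensional faces (where $P_n$ counts as a face of itself). Then $f_{d-1}(P_n)$ is integrable for every $n$, and $n\mapsto\mathbb E f_{d-1}(P_n)$ is nondecreasing. Let moreover $d\ge 2$. For a unit vector $\omega\in\mathbb R^d$ and $t\in\mathbb R$ put $H(t,\omega)=\{x:\langle x,\omega\rangle=t\}$, let $V_{d-1}$ be $(d-1)$-dimensional volume, and put $$\psi(t)=\int_{H(t,\omega)}\kappa_d^{-1}\mathbf 1(x\in B^d)\,dx,\qquad \Psi(p)=\int_{-\infty}^p\psi(t)\,dt .$$ For $-1<t<1$ let $\mathbb E_{H(t,\omega)}\Delta_{d-1}$ be the expected $(d-1)$-dimensional volume of the convex hull of $d$ independent uniform points in $H(t,\omega)\cap B^d$. Then the following hold. 1. $\psi(t)=\kappa_d^{-1}V_{d-1}(H(t,\omega)\cap B^d)$ for all $t$,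 and $\psi(t)=\kappa_d^{-1}\kappa_{d-1}(1-t^2)^{(d-1)/2}$ for $t\in[-1,1]$. The function $\Psi$ is strictly increasing on $[-1,1]$ and maps $[-1,1]$ bijectively onto $[0,1]$; let $\Psi^{-1}:[0,1]\to[-1,1]$ be its inverse. 2. There is a constant $a_d>0$ depending only on $d$ with $\psi(t)^{1/(d-1)}=a_d\sqrt{1-t^2}$ for $t\in[-1,1]$, and $\psi^{1/(d-1)}$ is concave on $[-1,1]$. 3. There is a constant $C_d>0$ depending only on $d$ with $\mathbb E_{H(t,\omega)}\Delta_{d-1}=C_d\,\psi(t)$ for all $\omega$ and all $t\in(-1,1)$. 4. Put $L(s)=\psi(\Psi^{-1}(s))\,\bigl(\mathbb E_{H(\Psi^{-1}(s),\omega)}\Delta_{d-1}\bigr)^{1/(d-1)}$ for $s\in(0,1)$ and $L(0)=L(1)=0$. There is a constant $c_d>0$ depending only on $d$ with $L(s)=c_d\,\psi(\Psi^{-1}(s))^{d/(d-1)}$ for all $\omega$ and all $s\in[0,1]$, and $L$ is concave on $[0,1]$. -/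

import Mathlib

open Set MeasureTheory ProbabilityTheory

noncomputable section

/-- The number `f_j(P)` of `j`-dimensional faces of a convex polytope `P`. A face is a set of
points of `P` at which some linear functional attains its maximum over `P` (the polytope itself
counts as a face, the empty set does not); its dimension is that of its affine hull. -/
def numFaces {E : Type*} [NormedAddCommGroup E] [NormedSpace ℝ E] (P : Set E) (j : ℕ) : ℕ :=
  {F : Set E | F.Nonempty ∧ IsExposed ℝ P F ∧ Module.finrank ℝ (vectorSpan ℝ F) = j}.ncard

/-- The convex hull `P_n` of the first `n` points `X 0, …, X (n - 1)`. -/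
def randomPolytope {Ω E : Type*} [AddCommGroup E] [Module ℝ E]
    (X : ℕ → Ω → E) (n : ℕ) (ω : Ω) : Set E :=
  convexHull ℝ ((fun i => X i ω) '' Iio n)

/-- The closed unit ball `B^d`. -/
def unitBall (d : ℕ) : Set (EuclideanSpace ℝ (Fin d)) :=
  Metric.closedBall 0 1

/-- The volume `κ_d` of the unit ball `B^d`. -/
def ballVolume (d : ℕ) : ℝ :=
  volume.real (unitBall d)

/-- The density of the uniform distribution in `B^d`. -/
def ballDensity (d : ℕ) : EuclideanSpace ℝ (Fin d) → ℝ :=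
  (unitBall d).indicator fun _ => (ballVolume d)⁻¹

/-- The hyperplane `H(t, u) = {x : ⟨x, u⟩ = t}`. -/
def hyperplane {d : ℕ} (u : EuclideanSpace ℝ (Fin d)) (t : ℝ) : Set (EuclideanSpace ℝ (Fin d)) :=
  {x | inner ℝ x u = t}

/-- `ψ(t)`, the integral over `H(t, u)` of the uniform density in the ball, with respect to
`(d-1)`-dimensional Lebesgue measure on the hyperplane. -/
def sectionDensity {d : ℕ} (u : EuclideanSpace ℝ (Fin d)) (t : ℝ) : ℝ :=
  ∫ x in hyperplane u t, ballDensity d x ∂μHE[d - 1]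

/-- `Ψ(p) = ∫_{-∞}^p ψ(t) dt`. -/
def sectionCdf {d : ℕ} (u : EuclideanSpace ℝ (Fin d)) (p : ℝ) : ℝ :=
  ∫ t in Iic p, sectionDensity u t

/-- `Ψ⁻¹`, the inverse of `Ψ` restricted to the support `[-1, 1]` of `ψ`. -/
def sectionQuantile {d : ℕ} (u : EuclideanSpace ℝ (Fin d)) : ℝ → ℝ :=
  Function.invFunOn (sectionCdf u) (Icc (-1) 1)

/-- The expected `(d-1)`-dimensional volume of the simplex spanned by `d` independent uniform
points in `H(t, u) ∩ B^d`. -/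
def expectedSimplexVolume {d : ℕ} (u : EuclideanSpace ℝ (Fin d)) (t : ℝ) : ℝ :=
  ∫ x : Fin d → EuclideanSpace ℝ (Fin d), (μHE[d - 1]).real (convexHull ℝ (range x))
    ∂Measure.pi fun _ => cond μHE[d - 1] (hyperplane u t ∩ unitBall d)

/-- `L(s) = ψ(Ψ⁻¹(s)) (E Δ_{d-1})^{1/(d-1)}`, where `E Δ_{d-1}` is the expected simplex volume in
the hyperplane `H(Ψ⁻¹(s), u)`. -/
def sectionProfile {d : ℕ} (u : EuclideanSpace ℝ (Fin d)) (s : ℝ) : ℝ :=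
  sectionDensity u (sectionQuantile u s) *
    expectedSimplexVolume u (sectionQuantile u s) ^ (1 / ((d : ℝ) - 1))

end

/-!
The expected number of facets is computed by counting, for `n` points in general position, the sets
of `d` points such that all the others lie strictly on one side of the hyperplane spanned by them
(`numFaces_convexHull_eq_card`). By symmetry, the expectation for `n > d` is `n.choose d` times the
expectation of `F(h)^(n-d) + F(-h)^(n-d)`, where `h` is the signed distance from the origin of the
hyperplane through `d` uniform points and `F = capCdf (d - 1)` is the distribution function of a
coordinate of a uniform point, so that the caps cut off by the hyperplane have contents `F(h)` and
`F(-h)`.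

The law of `h` comes from an affine Blaschke–Petkantschin formula in graph coordinates
(`lintegral_points_eq_lintegral_graph`): a hyperplane is written as the graph of an affine function
on `ℝ^(d-1)`, and for fixed projections `y i` of the `d` points their heights depend linearly on the
coefficients of that function, with Jacobian the determinant with rows `(1, y i)`. For a fixed graph,
the projection of its section with the ball is the image of the unit ball under an affine map of
known determinant, hence the integral over the `y i` is a constant times a power of the volume of
the section (`graphMoment_eq`). The density of `h` is therefore proportional to
`(1 - h²)^((d²-1)/2)` (`exists_expectedSideProb_eq`); the constant follows by normalization.

With `ℓ(h) = (1 - h²)^(d/2)`, this density is a constant times `F' ℓ^(d-1)`. As a function of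
`s = F(h)`, `ℓ` is concave, by Cauchy's mean value theorem, because `ℓ' / F'` is a negative multiple
of `h / √(1 - h²)` (`capCdf_slope_antitone`). This is the concavity of the profile, and it also
shows that `ℓ / (1 - F)` is nondecreasing. Monotonicity of the expectation amounts to
`∫ F^(m-1) (F - m/(m+d)) F' ℓ^(d-1) ≥ 0` for `m = n + 1 - d`; replacing `ℓ / (1 - F)` by its value
at the sign change decreases the integral to a multiple of the integral of the derivative of
`F^m (1-F)^d`, which vanishes (`integral_capCdf_pow_mul_sub_nonneg`).

The statements on sections follow from the isometric parametrization of a hyperplane by the space of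
one dimension less (`exists_linearIsometry_range_eq_hyperplane`), under which a section of the ball
is a ball of radius `√(1 - t²)`; the expected simplex volume is then computed by scaling.
-/

/-! ### Hyperplane sections of the ball -/

theorem measurableSet_unitBall (d : ℕ) : MeasurableSet (unitBall d) :=
  Metric.isClosed_closedBall.measurableSet

theorem volume_unitBall_ne_top (d : ℕ) : volume (unitBall d) ≠ ⊤ :=
  measure_closedBall_lt_top.ne

theorem volume_unitBall_ne_zero (d : ℕ) : volume (unitBall d) ≠ 0 :=
  (Metric.measure_closedBall_pos volume _ one_pos).ne'

theorem ballVolume_pos (d : ℕ) : 0 < ballVolume d :=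
  ENNReal.toReal_pos (volume_unitBall_ne_zero d) (volume_unitBall_ne_top d)

theorem ofReal_ballVolume (d : ℕ) : ENNReal.ofReal (ballVolume d) = volume (unitBall d) :=
  ENNReal.ofReal_toReal (volume_unitBall_ne_top d)

theorem volume_closedBall_zero (k : ℕ) {r : ℝ} (hr : 0 ≤ r) :
    volume (Metric.closedBall (0 : EuclideanSpace ℝ (Fin k)) r)
      = ENNReal.ofReal (ballVolume k * r ^ k) := by
  rw [Measure.addHaar_closedBall' _ _ hr, finrank_euclideanSpace_fin,
    ENNReal.ofReal_mul (ballVolume_pos k).le, ofReal_ballVolume, mul_comm]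
  rfl

/-- Every hyperplane `H(t, u)` with unit normal `u` is parametrized isometrically by the Euclidean
space of one dimension less, with the point `t u` corresponding to the origin. -/
theorem exists_linearIsometry_range_eq_hyperplane {k : ℕ} {u : EuclideanSpace ℝ (Fin (k + 1))}
    (hu : ‖u‖ = 1) :
    ∃ V : EuclideanSpace ℝ (Fin k) →ₗᵢ[ℝ] EuclideanSpace ℝ (Fin (k + 1)),
      (∀ y, inner ℝ (V y) u = 0) ∧ ∀ t : ℝ, range (fun y => t • u + V y) = hyperplane u t := by
  have hu0 : u ≠ 0 := by
    rintro rfl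
    simp at hu
  have : Fact (Module.finrank ℝ (EuclideanSpace ℝ (Fin (k + 1))) = k + 1) :=
    ⟨finrank_euclideanSpace_fin⟩
  let b := OrthonormalBasis.fromOrthogonalSpanSingleton (𝕜 := ℝ) k hu0
  have hV : ∀ y, inner ℝ (((ℝ ∙ u)ᗮ.subtypeₗᵢ.comp b.repr.symm.toLinearIsometry) y) u = 0 := by
    intro y
    have := (b.repr.symm y).2
    rw [Submodule.mem_orthogonal_singleton_iff_inner_left] at this
    exact this
  refine ⟨(ℝ ∙ u)ᗮ.subtypeₗᵢ.comp b.repr.symm.toLinearIsometry, hV, fun t => ?_⟩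
  ext x
  constructor
  · rintro ⟨y, rfl⟩
    simp only [hyperplane, mem_ofPred_eq, inner_add_left, hV, inner_smul_left,
      real_inner_self_eq_norm_sq, hu]
    simp
  · intro hx
    have hx' : x - t • u ∈ (ℝ ∙ u)ᗮ := by
      rw [Submodule.mem_orthogonal_singleton_iff_inner_left, inner_sub_left, inner_smul_left,
        real_inner_self_eq_norm_sq, hu]
      have : inner ℝ x u = t := hx
      simp [this]
    refine ⟨b.repr ⟨_, hx'⟩, ?_⟩
    simp

theorem isometry_hyperplaneChart {k : ℕ} (u : EuclideanSpace ℝ (Fin (k + 1)))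
    (V : EuclideanSpace ℝ (Fin k) →ₗᵢ[ℝ] EuclideanSpace ℝ (Fin (k + 1))) (t : ℝ) :
    Isometry fun y => t • u + V y := by
  refine Isometry.of_dist_eq fun x y => ?_
  simp [V.isometry.dist_eq]

theorem hyperplaneChart_mem_unitBall_iff {k : ℕ} {u : EuclideanSpace ℝ (Fin (k + 1))}
    (hu : ‖u‖ = 1) {V : EuclideanSpace ℝ (Fin k) →ₗᵢ[ℝ] EuclideanSpace ℝ (Fin (k + 1))}
    (hV : ∀ y, inner ℝ (V y) u = 0) (t : ℝ) (y : EuclideanSpace ℝ (Fin k)) :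
    t • u + V y ∈ unitBall (k + 1) ↔ ‖y‖ ^ 2 ≤ 1 - t ^ 2 := by
  have h : ‖t • u + V y‖ ^ 2 = t ^ 2 + ‖y‖ ^ 2 := by
    have h0 : inner ℝ (t • u) (V y) = 0 := by
      rw [real_inner_comm, inner_smul_right, hV, mul_zero]
    rw [norm_add_sq_real, h0, norm_smul, hu, V.norm_map]
    simp
  rw [unitBall, mem_closedBall_zero_iff, ← sq_le_one_iff₀ (norm_nonneg _), h]
  constructor <;> intro h <;> linarith

theorem hyperplane_inter_unitBall_eq_image {k : ℕ} {u : EuclideanSpace ℝ (Fin (k + 1))}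
    (hu : ‖u‖ = 1) {V : EuclideanSpace ℝ (Fin k) →ₗᵢ[ℝ] EuclideanSpace ℝ (Fin (k + 1))}
    (hV : ∀ y, inner ℝ (V y) u = 0) {t : ℝ} (hr : range (fun y => t • u + V y) = hyperplane u t)
    (ht : t ∈ Icc (-1 : ℝ) 1) :
    hyperplane u t ∩ unitBall (k + 1)
      = (fun y => t • u + V y) '' Metric.closedBall 0 (√(1 - t ^ 2)) := by
  have ht' : 0 ≤ 1 - t ^ 2 := by nlinarith [ht.1, ht.2]
  rw [← hr]
  ext x
  constructor
  · rintro ⟨⟨y, rfl⟩, hy⟩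
    refine ⟨y, ?_, rfl⟩
    rw [hyperplaneChart_mem_unitBall_iff hu hV] at hy
    rw [mem_closedBall_zero_iff]
    exact Real.le_sqrt_of_sq_le hy
  · rintro ⟨y, hy, rfl⟩
    refine ⟨⟨y, rfl⟩, ?_⟩
    rw [hyperplaneChart_mem_unitBall_iff hu hV]
    rw [mem_closedBall_zero_iff] at hy
    calc ‖y‖ ^ 2 ≤ √(1 - t ^ 2) ^ 2 := by gcongr
      _ = _ := Real.sq_sqrt ht'

theorem hyperplane_inter_unitBall_eq_empty {d : ℕ} {u : EuclideanSpace ℝ (Fin d)}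
    (hu : ‖u‖ = 1) {t : ℝ} (ht : t ∉ Icc (-1 : ℝ) 1) : hyperplane u t ∩ unitBall d = ∅ := by
  rw [eq_empty_iff_forall_notMem]
  rintro x ⟨hx, hx1⟩
  apply ht
  rw [unitBall, mem_closedBall_zero_iff] at hx1
  have h := abs_real_inner_le_norm x u
  have hx' : inner ℝ x u = t := hx
  rw [hu, mul_one, hx'] at h
  exact abs_le.1 (h.trans hx1)

/-- The section function of the uniform density in the ball of dimension `k + 1`. The indicator is
needed for `k = 0`, where the power is `1`, and because the real power of a negative number need
not vanish. -/
noncomputable def capDensity (k : ℕ) : ℝ → ℝ :=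
  (Icc (-1) 1).indicator fun t =>
    (ballVolume (k + 1))⁻¹ * ballVolume k * (1 - t ^ 2) ^ ((k : ℝ) / 2)

theorem capDensity_nonneg (k : ℕ) (t : ℝ) : 0 ≤ capDensity k t := by
  refine indicator_nonneg (fun t ht => ?_) t
  have ht' : 0 ≤ 1 - t ^ 2 := by nlinarith [ht.1, ht.2]
  have := ballVolume_pos (k + 1)
  have := ballVolume_pos k
  positivity

theorem hyperplane_measure_inter_unitBall {k : ℕ} {u : EuclideanSpace ℝ (Fin (k + 1))}
    (hu : ‖u‖ = 1) (t : ℝ) :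
    μHE[k] (hyperplane u t ∩ unitBall (k + 1))
      = ENNReal.ofReal (ballVolume (k + 1) * capDensity k t) := by
  by_cases ht : t ∈ Icc (-1 : ℝ) 1
  · obtain ⟨V, hV, hr⟩ := exists_linearIsometry_range_eq_hyperplane hu
    have ht' : 0 ≤ 1 - t ^ 2 := by nlinarith [ht.1, ht.2]
    rw [hyperplane_inter_unitBall_eq_image hu hV (hr t) ht,
      (isometry_hyperplaneChart u V t).euclideanHausdorffMeasure_image,
      EuclideanSpace.euclideanHausdorffMeasure_eq_volume,
      volume_closedBall_zero _ (Real.sqrt_nonneg _), capDensity, indicator_of_mem ht,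
      Real.sqrt_eq_rpow, ← Real.rpow_mul_natCast ht']
    congr 1
    have := (ballVolume_pos (k + 1)).ne'
    rw [show (1 / 2 * (k : ℝ)) = k / 2 by ring]
    field_simp
  · rw [hyperplane_inter_unitBall_eq_empty hu ht, capDensity, indicator_of_notMem ht]
    simp

theorem sectionDensity_eq_real {d : ℕ} (u : EuclideanSpace ℝ (Fin d)) (t : ℝ) :
    sectionDensity u t
      = (ballVolume d)⁻¹ * (μHE[d - 1]).real (hyperplane u t ∩ unitBall d) := by
  rw [sectionDensity, ballDensity, setIntegral_indicator (measurableSet_unitBall d),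
    setIntegral_const, smul_eq_mul, mul_comm]

theorem sectionDensity_eq_capDensity {k : ℕ} {u : EuclideanSpace ℝ (Fin (k + 1))}
    (hu : ‖u‖ = 1) (t : ℝ) : sectionDensity u t = capDensity k t := by
  have h0 := ballVolume_pos (k + 1)
  rw [sectionDensity_eq_real, Nat.add_sub_cancel, Measure.real,
    hyperplane_measure_inter_unitBall hu,
    ENNReal.toReal_ofReal (mul_nonneg h0.le (capDensity_nonneg k t))]
  field_simp

/-! ### The distribution function of the caps -/

/-- The distribution function of a coordinate of a uniform random point in the ball of dimension
`k + 1`. -/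
noncomputable def capCdf (k : ℕ) (t : ℝ) : ℝ :=
  ∫ s in Iic t, capDensity k s

theorem sectionCdf_eq_capCdf {k : ℕ} {u : EuclideanSpace ℝ (Fin (k + 1))}
    (hu : ‖u‖ = 1) (t : ℝ) : sectionCdf u t = capCdf k t := by
  simp only [sectionCdf, capCdf, sectionDensity_eq_capDensity hu]

theorem continuous_one_sub_sq_rpow {p : ℝ} (hp : 0 ≤ p) :
    Continuous fun t : ℝ => (1 - t ^ 2) ^ p :=
  Continuous.rpow_const (by fun_prop) fun _ => Or.inr hp

theorem integrable_capDensity (k : ℕ) : Integrable (capDensity k) := by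
  refine (integrable_indicator_iff measurableSet_Icc).2 ?_
  exact (continuous_const.mul
    (continuous_one_sub_sq_rpow (by positivity))).continuousOn.integrableOn_Icc

theorem capDensity_of_mem {k : ℕ} {t : ℝ} (ht : t ∈ Icc (-1 : ℝ) 1) :
    capDensity k t = (ballVolume (k + 1))⁻¹ * ballVolume k * (1 - t ^ 2) ^ ((k : ℝ) / 2) :=
  indicator_of_mem ht _

theorem capDensity_pos {k : ℕ} {t : ℝ} (ht : t ∈ Ioo (-1 : ℝ) 1) : 0 < capDensity k t := by
  rw [capDensity_of_mem (Ioo_subset_Icc_self ht)]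
  have ht' : 0 < 1 - t ^ 2 := by nlinarith [ht.1, ht.2]
  have := ballVolume_pos (k + 1)
  have := ballVolume_pos k
  positivity

theorem capDensity_neg (k : ℕ) (t : ℝ) : capDensity k (-t) = capDensity k t := by
  by_cases ht : t ∈ Icc (-1 : ℝ) 1
  · have ht' : -t ∈ Icc (-1 : ℝ) 1 := ⟨by linarith [ht.2], by linarith [ht.1]⟩
    rw [capDensity_of_mem ht, capDensity_of_mem ht', neg_sq]
  · have ht' : -t ∉ Icc (-1 : ℝ) 1 := fun h => ht ⟨by linarith [h.2], by linarith [h.1]⟩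
    rw [capDensity, indicator_of_notMem ht, indicator_of_notMem ht']

theorem capCdf_neg_one (k : ℕ) : capCdf k (-1) = 0 := by
  refine (setIntegral_congr_set Iio_ae_eq_Iic).symm.trans ?_
  refine setIntegral_eq_zero_of_forall_eq_zero fun t ht => indicator_of_notMem (fun h => ?_) _
  exact absurd h.1 (not_le.2 ht)

theorem capCdf_sub (k : ℕ) (s t : ℝ) : capCdf k t - capCdf k s = ∫ x in s..t, capDensity k x :=
  intervalIntegral.integral_Iic_sub_Iic (integrable_capDensity k).integrableOn
    (integrable_capDensity k).integrableOn

theorem capCdf_eq_intervalIntegral {k : ℕ} {t : ℝ} (ht : t ∈ Icc (-1 : ℝ) 1) :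
    capCdf k t = ∫ s in (-1 : ℝ)..t,
      (ballVolume (k + 1))⁻¹ * ballVolume k * (1 - s ^ 2) ^ ((k : ℝ) / 2) := by
  have h := capCdf_sub k (-1) t
  rw [capCdf_neg_one, sub_zero] at h
  rw [h]
  refine intervalIntegral.integral_congr fun s hs => ?_
  rw [uIcc_of_le ht.1] at hs
  exact capDensity_of_mem ⟨hs.1, hs.2.trans ht.2⟩

theorem hasDerivAt_capCdf {k : ℕ} {t : ℝ} (ht : t ∈ Ioo (-1 : ℝ) 1) :
    HasDerivAt (capCdf k) (capDensity k t) t := by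
  have hc : Continuous fun s : ℝ =>
      (ballVolume (k + 1))⁻¹ * ballVolume k * (1 - s ^ 2) ^ ((k : ℝ) / 2) :=
    continuous_const.mul (continuous_one_sub_sq_rpow (by positivity))
  have h := intervalIntegral.integral_hasDerivAt_right (hc.intervalIntegrable (-1) t)
    (hc.stronglyMeasurableAtFilter _ _) hc.continuousAt
  rw [capDensity_of_mem (Ioo_subset_Icc_self ht)]
  refine h.congr_of_eventuallyEq ?_
  filter_upwards [isOpen_Ioo.mem_nhds ht] with s hs
  exact capCdf_eq_intervalIntegral (Ioo_subset_Icc_self hs)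

theorem continuous_capCdf (k : ℕ) : Continuous (capCdf k) := by
  have h : capCdf k = fun t => capCdf k 0 + ∫ x in (0 : ℝ)..t, capDensity k x := by
    ext t
    rw [← capCdf_sub]
    ring
  rw [h]
  exact continuous_const.add (intervalIntegral.continuous_primitive
    (fun _ _ => (integrable_capDensity k).intervalIntegrable) 0)

theorem monotone_capCdf (k : ℕ) : Monotone (capCdf k) := fun s t hst => by
  rw [← sub_nonneg, capCdf_sub]
  exact intervalIntegral.integral_nonneg hst fun _ _ => capDensity_nonneg k _

theorem capCdf_nonneg (k : ℕ) (t : ℝ) : 0 ≤ capCdf k t :=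
  setIntegral_nonneg measurableSet_Iic fun _ _ => capDensity_nonneg k _

theorem strictMonoOn_capCdf (k : ℕ) : StrictMonoOn (capCdf k) (Icc (-1) 1) := by
  refine strictMonoOn_of_deriv_pos (convex_Icc _ _) (continuous_capCdf k).continuousOn ?_
  intro t ht
  rw [interior_Icc] at ht
  rw [(hasDerivAt_capCdf ht).deriv]
  exact capDensity_pos ht

theorem coe_mk'_orthogonal_eq_hyperplane {d : ℕ} {u : EuclideanSpace ℝ (Fin d)}
    (hu : ‖u‖ = 1) (x : ℝ) :
    (AffineSubspace.mk' (x • u +ᵥ (0 : EuclideanSpace ℝ (Fin d))) (ℝ ∙ u)ᗮ : Set _)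
      = hyperplane u x := by
  ext z
  simp only [SetLike.mem_coe, AffineSubspace.mem_mk', vsub_eq_sub, vadd_eq_add, add_zero,
    Submodule.mem_orthogonal_singleton_iff_inner_left, hyperplane, mem_ofPred_eq, inner_sub_left,
    inner_smul_left, real_inner_self_eq_norm_sq, hu]
  simp [sub_eq_zero]

/-- The volume of the part of the ball that lies below a hyperplane. -/
theorem volume_unitBall_inter_lt {k : ℕ} {u : EuclideanSpace ℝ (Fin (k + 1))}
    (hu : ‖u‖ = 1) (t : ℝ) :
    volume (unitBall (k + 1) ∩ {z | inner ℝ z u < t})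
      = ENNReal.ofReal (ballVolume (k + 1) * capCdf k t) := by
  have hu0 : u ≠ 0 := by
    rintro rfl
    simp at hu
  have hm : MeasurableSet (unitBall (k + 1) ∩ {z | inner ℝ z u < t}) :=
    (measurableSet_unitBall _).inter (measurableSet_lt (by fun_prop) (by fun_prop))
  have h := EuclideanGeometry.euclideanHausdorffMeasure_eq_lintegral
    (0 : EuclideanSpace ℝ (Fin (k + 1))) hu0 hm
  rw [InnerProductSpace.euclideanHausdorffMeasure_eq_volume, finrank_euclideanSpace_fin,
    Nat.add_sub_cancel] at h
  rw [h, ← ofReal_norm, hu, ENNReal.ofReal_one, one_mul]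
  -- Integrate the volumes of the sections orthogonal to `u`.
  have hsec : ∀ x : ℝ, μHE[k] (unitBall (k + 1) ∩ {z | inner ℝ z u < t} ∩
      (AffineSubspace.mk' (x • u +ᵥ (0 : EuclideanSpace ℝ (Fin (k + 1)))) (ℝ ∙ u)ᗮ : Set _))
      = (Iio t).indicator
        (fun x => ENNReal.ofReal (ballVolume (k + 1) * capDensity k x)) x := by
    intro x
    rw [coe_mk'_orthogonal_eq_hyperplane hu]
    by_cases hx : x ∈ Iio t
    · rw [indicator_of_mem hx, ← hyperplane_measure_inter_unitBall hu]
      congr 1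
      ext z
      simp only [mem_inter_iff, mem_ofPred_eq, hyperplane]
      constructor
      · rintro ⟨⟨h1, _⟩, h3⟩
        exact ⟨h3, h1⟩
      · rintro ⟨h1, h2⟩
        exact ⟨⟨h2, h1 ▸ hx⟩, h1⟩
    · rw [indicator_of_notMem hx]
      suffices h0 : unitBall (k + 1) ∩ {z | inner ℝ z u < t} ∩ hyperplane u x = ∅ by
        rw [h0, measure_empty]
      rw [eq_empty_iff_forall_notMem]
      rintro z ⟨⟨_, h2⟩, h3⟩
      exact hx ((show inner ℝ z u = x from h3) ▸ h2)
  simp_rw [hsec]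
  rw [lintegral_indicator measurableSet_Iio, ← ofReal_integral_eq_lintegral_ofReal
    ((integrable_capDensity k).const_mul _).integrableOn
    (Filter.Eventually.of_forall fun x => mul_nonneg (ballVolume_pos _).le (capDensity_nonneg k x)),
    integral_const_mul, setIntegral_congr_set Iio_ae_eq_Iic]
  rfl

theorem capCdf_eq_capCdf_one {k : ℕ} {t : ℝ} (ht : 1 ≤ t) : capCdf k t = capCdf k 1 := by
  rw [← sub_eq_zero, capCdf_sub, intervalIntegral.integral_of_le ht]
  refine setIntegral_eq_zero_of_forall_eq_zero fun s hs => indicator_of_notMem (fun h => ?_) _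
  exact absurd h.2 (not_le.2 hs.1)

theorem capCdf_one (k : ℕ) : capCdf k 1 = 1 := by
  obtain ⟨u, hu⟩ : ∃ u : EuclideanSpace ℝ (Fin (k + 1)), ‖u‖ = 1 :=
    exists_norm_eq _ zero_le_one
  have h := volume_unitBall_inter_lt hu 2
  -- The half-space below height `2` contains the whole ball.
  have h2 : unitBall (k + 1) ∩ {z | inner ℝ z u < 2} = unitBall (k + 1) := by
    refine inter_eq_left.2 fun z hz => ?_
    rw [unitBall, mem_closedBall_zero_iff] at hz
    have := real_inner_le_norm z u
    rw [hu, mul_one] at this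
    exact lt_of_le_of_lt (this.trans hz) one_lt_two
  rw [h2, ← ofReal_ballVolume, ENNReal.ofReal_eq_ofReal_iff (ballVolume_pos _).le
    (mul_nonneg (ballVolume_pos _).le (capCdf_nonneg _ _)),
    capCdf_eq_capCdf_one one_le_two] at h
  exact (mul_left_cancel₀ (ballVolume_pos (k + 1)).ne' (h.symm.trans (mul_one _).symm))

theorem capCdf_le_one (k : ℕ) (t : ℝ) : capCdf k t ≤ 1 := by
  rcases le_total t 1 with h | h
  · exact (monotone_capCdf k h).trans (capCdf_one k).le
  · rw [capCdf_eq_capCdf_one h, capCdf_one]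

theorem capCdf_neg (k : ℕ) (t : ℝ) : capCdf k (-t) = 1 - capCdf k t := by
  have htot : ∫ x, capDensity k x = 1 := by
    rw [← capCdf_one k, capCdf, ← integral_indicator measurableSet_Iic]
    refine integral_congr_ae (Filter.Eventually.of_forall fun x => ?_)
    by_cases hx : x ∈ Iic (1 : ℝ)
    · simp only [indicator_of_mem hx]
    · simp only [indicator_of_notMem hx]
      exact indicator_of_notMem (fun h => hx h.2) _
  have h1 : capCdf k (-t) = ∫ x in Ioi t, capDensity k x := by
    have h := integral_comp_neg_Iic (-t) (capDensity k)
    simp only [capDensity_neg, neg_neg] at h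
    exact h
  rw [h1, ← htot, capCdf, ← intervalIntegral.integral_Iic_add_Ioi
    (integrable_capDensity k).integrableOn (integrable_capDensity k).integrableOn (b := t)]
  ring

theorem bijOn_capCdf (k : ℕ) : BijOn (capCdf k) (Icc (-1) 1) (Icc 0 1) := by
  refine ⟨fun t _ => ⟨capCdf_nonneg k t, capCdf_le_one k t⟩, (strictMonoOn_capCdf k).injOn, ?_⟩
  have h := intermediate_value_Icc (show (-1 : ℝ) ≤ 1 by norm_num)
    (continuous_capCdf k).continuousOn
  rwa [capCdf_neg_one, capCdf_one] at h

open scoped Pointwise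

/-! ### Concavity of the profile -/

theorem hasDerivAt_one_sub_sq_rpow {t : ℝ} (ht : t ∈ Ioo (-1 : ℝ) 1) (p : ℝ) :
    HasDerivAt (fun t : ℝ => (1 - t ^ 2) ^ p) (-(2 * p) * t * (1 - t ^ 2) ^ (p - 1)) t := by
  have ht' : 0 < 1 - t ^ 2 := by nlinarith [ht.1, ht.2]
  have h1 : HasDerivAt (fun t : ℝ => 1 - t ^ 2) (-(2 * t)) t := by
    simpa using (hasDerivAt_pow 2 t).const_sub 1
  convert! h1.rpow_const (p := p) (Or.inl ht'.ne') using 1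
  ring

/-- The function `t ↦ t / √(1 - t²) = tan (arcsin t)` is increasing. -/
theorem div_sqrt_one_sub_sq_le {s t : ℝ} (hs : -1 < s) (hst : s < t) (ht : t < 1) :
    s / √(1 - s ^ 2) ≤ t / √(1 - t ^ 2) := by
  rw [← Real.tan_arcsin, ← Real.tan_arcsin]
  refine (Real.tan_lt_tan_of_lt_of_lt_pi_div_two ?_ ?_ ?_).le
  · exact Real.neg_pi_div_two_lt_arcsin.2 hs
  · exact Real.arcsin_lt_pi_div_two.2 ht
  · exact Real.strictMonoOn_arcsin ⟨hs.le, (hst.trans ht).le⟩ ⟨(hs.trans hst).le, ht.le⟩ hst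

/-- As a function of the probability content `capCdf k t`, the function `(1 - t²)^((k+1)/2)` has
decreasing slopes: the ratio of the derivatives with respect to `t` is a negative multiple of
`t / √(1 - t²)`. -/
theorem capCdf_slope_antitone {k : ℕ} {t₁ t₂ t₃ : ℝ} (h₁ : -1 ≤ t₁) (h₁₂ : t₁ < t₂)
    (h₂₃ : t₂ < t₃) (h₃ : t₃ ≤ 1) :
    ((1 - t₃ ^ 2) ^ (((k : ℝ) + 1) / 2) - (1 - t₂ ^ 2) ^ (((k : ℝ) + 1) / 2))
        / (capCdf k t₃ - capCdf k t₂)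
      ≤ ((1 - t₂ ^ 2) ^ (((k : ℝ) + 1) / 2) - (1 - t₁ ^ 2) ^ (((k : ℝ) + 1) / 2))
        / (capCdf k t₂ - capCdf k t₁) := by
  set p : ℝ := ((k : ℝ) + 1) / 2 with hp
  have hp0 : 0 ≤ p := by positivity
  set C := (ballVolume (k + 1))⁻¹ * ballVolume k with hC
  have hC0 : 0 < C := mul_pos (inv_pos.2 (ballVolume_pos _)) (ballVolume_pos _)
  -- Cauchy's mean value theorem expresses the slopes by the ratio of the derivatives.
  have key : ∀ a b : ℝ, -1 ≤ a → a < b → b ≤ 1 → ∃ c ∈ Ioo a b,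
      ((1 - b ^ 2) ^ p - (1 - a ^ 2) ^ p) / (capCdf k b - capCdf k a)
        = -(2 * p / C) * (c / √(1 - c ^ 2)) := by
    intro a b ha hab hb
    have hsub : Ioo a b ⊆ Ioo (-1) 1 := Ioo_subset_Ioo ha hb
    obtain ⟨c, hc, h⟩ := exists_ratio_hasDerivAt_eq_ratio_slope
      (fun t : ℝ => (1 - t ^ 2) ^ p) (fun t => -(2 * p) * t * (1 - t ^ 2) ^ (p - 1)) hab
      (continuous_one_sub_sq_rpow hp0).continuousOn
      (fun x hx => hasDerivAt_one_sub_sq_rpow (hsub hx) p) (capCdf k) (capDensity k)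
      (continuous_capCdf k).continuousOn (fun x hx => hasDerivAt_capCdf (hsub hx))
    refine ⟨c, hc, ?_⟩
    have hc1 := hsub hc
    have hc' : 0 < 1 - c ^ 2 := by nlinarith [hc1.1, hc1.2]
    have hF : 0 < capCdf k b - capCdf k a := sub_pos.2
      (strictMonoOn_capCdf k ⟨ha, hab.le.trans hb⟩ ⟨ha.trans hab.le, hb⟩ hab)
    have hpow : (1 - c ^ 2) ^ ((k : ℝ) / 2) = (1 - c ^ 2) ^ (p - 1) * √(1 - c ^ 2) := by
      rw [Real.sqrt_eq_rpow, ← Real.rpow_add hc', hp]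
      ring_nf
    have hpos : 0 < (1 - c ^ 2) ^ (p - 1) := Real.rpow_pos_of_pos hc' _
    have hsq : 0 < √(1 - c ^ 2) := Real.sqrt_pos.2 hc'
    rw [capDensity_of_mem (Ioo_subset_Icc_self hc1), hpow, ← hC] at h
    rw [div_eq_iff hF.ne']
    have h2 : ((1 - b ^ 2) ^ p - (1 - a ^ 2) ^ p) * (C * √(1 - c ^ 2))
        = (capCdf k b - capCdf k a) * (-(2 * p) * c) := by
      refine mul_right_cancel₀ hpos.ne' ?_
      linear_combination -h
    field_simp
    linear_combination h2
  obtain ⟨c, hc, h⟩ := key t₁ t₂ h₁ h₁₂ (h₂₃.le.trans h₃)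
  obtain ⟨e, he, h'⟩ := key t₂ t₃ (h₁.trans h₁₂.le) h₂₃ h₃
  rw [h, h']
  refine mul_le_mul_of_nonpos_left ?_ (neg_nonpos.2 (by positivity))
  exact div_sqrt_one_sub_sq_le (h₁.trans_lt hc.1) (hc.2.trans he.1) (he.2.trans_le h₃)

theorem concaveOn_comp_capCdf_inverse {k : ℕ} {q : ℝ → ℝ}
    (hq : ∀ s ∈ Icc (0 : ℝ) 1, q s ∈ Icc (-1 : ℝ) 1 ∧ capCdf k (q s) = s) :
    ConcaveOn ℝ (Icc 0 1) fun s => (1 - q s ^ 2) ^ (((k : ℝ) + 1) / 2) := by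
  have hmono : ∀ x ∈ Icc (0 : ℝ) 1, ∀ y ∈ Icc (0 : ℝ) 1, x < y → q x < q y := by
    intro x hx y hy hxy
    rw [← (strictMonoOn_capCdf k).lt_iff_lt (hq x hx).1 (hq y hy).1, (hq x hx).2, (hq y hy).2]
    exact hxy
  refine concaveOn_of_slope_anti_adjacent (convex_Icc 0 1) ?_
  intro x y z hx hz hxy hyz
  have hy : y ∈ Icc (0 : ℝ) 1 := ⟨hx.1.trans hxy.le, hyz.le.trans hz.2⟩
  have h := capCdf_slope_antitone (k := k) (hq x hx).1.1 (hmono x hx y hy hxy)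
    (hmono y hy z hz hyz) (hq z hz).1.2
  rwa [(hq x hx).2, (hq y hy).2, (hq z hz).2] at h

/-- The chord of the concave profile towards its zero at the right end point gets steeper. -/
theorem one_sub_sq_rpow_mul_le {k : ℕ} {s t : ℝ} (hs : -1 < s) (hst : s ≤ t) (ht : t < 1) :
    (1 - s ^ 2) ^ (((k : ℝ) + 1) / 2) * (1 - capCdf k t)
      ≤ (1 - t ^ 2) ^ (((k : ℝ) + 1) / 2) * (1 - capCdf k s) := by
  rcases hst.eq_or_lt with rfl | hst
  · rfl
  have h := capCdf_slope_antitone (k := k) hs.le hst ht le_rfl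
  have h1 : 0 < capCdf k t - capCdf k s := sub_pos.2
    (strictMonoOn_capCdf k ⟨hs.le, (hst.trans ht).le⟩ ⟨(hs.trans hst).le, ht.le⟩ hst)
  have h2 : 0 < 1 - capCdf k t := by
    rw [← capCdf_one k]
    exact sub_pos.2 (strictMonoOn_capCdf k ⟨(hs.trans hst).le, ht.le⟩ ⟨by norm_num, le_rfl⟩ ht)
  rw [capCdf_one, one_pow, sub_self, Real.zero_rpow (by positivity), div_le_div_iff₀ h2 h1] at h
  linarith

/-! ### Affine independence of random points -/

theorem AffineIndependent.fin_cons {E : Type*} [AddCommGroup E] [Module ℝ E] {m : ℕ}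
    {a : E} {x : Fin m → E} (hx : AffineIndependent ℝ x) (ha : a ∉ affineSpan ℝ (range x)) :
    AffineIndependent ℝ (Fin.cons a x : Fin (m + 1) → E) := by
  refine AffineIndependent.affineIndependent_of_notMem_span (i := 0) ?_ ?_
  · rw [← affineIndependent_equiv (finSuccAboveEquiv (0 : Fin (m + 1)))]
    convert! hx using 1
  · have : (Fin.cons a x : Fin (m + 1) → E) '' {x | x ≠ 0} = range x := by
      ext z
      constructor
      · rintro ⟨i, hi, rfl⟩
        obtain ⟨j, rfl⟩ := Fin.exists_succ_eq.2 hi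
        exact ⟨j, by simp⟩
      · rintro ⟨j, rfl⟩
        exact ⟨j.succ, Fin.succ_ne_zero j, by simp⟩
    rw [this]
    simpa using ha

/-- At most `dim E + 1` independent random points are almost surely affinely independent if their
distribution charges no proper affine subspace. -/
theorem ae_affineIndependent {E : Type*} [NormedAddCommGroup E] [NormedSpace ℝ E]
    [FiniteDimensional ℝ E] [MeasurableSpace E] [BorelSpace E] {μ : Measure E} [SigmaFinite μ]
    (hμ : ∀ s : AffineSubspace ℝ E, s ≠ ⊤ → μ s = 0) {m : ℕ}
    (hm : m ≤ Module.finrank ℝ E + 1) :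
    ∀ᵐ x ∂Measure.pi (fun _ : Fin m => μ), AffineIndependent ℝ x := by
  induction m with
  | zero => exact Filter.Eventually.of_forall fun x => affineIndependent_of_subsingleton ℝ x
  | succ m ih =>
    specialize ih (by omega)
    have hmp := (measurePreserving_piFinSuccAbove (fun _ : Fin (m + 1) => μ) 0).symm
    rw [← hmp.map_eq]
    have hmeas : MeasurableSet {x : Fin (m + 1) → E | AffineIndependent ℝ x} :=
      isOpen_setOfPred_affineIndependent.measurableSet
    rw [ae_map_iff hmp.measurable.aemeasurable hmeas]
    have hmeas' := hmp.measurable hmeas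
    refine (Measure.ae_prod_mem_iff_ae_ae_mem hmeas').2 ?_
    refine (Measure.ae_ae_comm (p := fun x y =>
      (x, y) ∈ (MeasurableEquiv.piFinSuccAbove (fun _ : Fin (m + 1) => E) 0).symm ⁻¹'
        {x | AffineIndependent ℝ x}) hmeas').2 ?_
    filter_upwards [ih] with x hx
    have htop : affineSpan ℝ (range x) ≠ ⊤ := by
      intro h
      have := hx.affineSpan_eq_top_iff_card_eq_finrank_add_one.1 h
      rw [Fintype.card_fin] at this
      omega
    have h0 := hμ _ htop
    rw [measure_eq_zero_iff_ae_notMem] at h0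
    filter_upwards [h0] with a ha
    have := hx.fin_cons ha
    simpa [MeasurableEquiv.piFinSuccAbove, Fin.insertNthEquiv] using this

theorem addHaar_affineSubspace_cond {E : Type*} [NormedAddCommGroup E] [NormedSpace ℝ E]
    [FiniteDimensional ℝ E] [MeasurableSpace E] [BorelSpace E] (μ : Measure E)
    [μ.IsAddHaarMeasure] (A : Set E) (s : AffineSubspace ℝ E) (hs : s ≠ ⊤) : μ[|A] s = 0 :=
  cond_absolutelyContinuous (Measure.addHaar_affineSubspace μ s hs)

/-! ### The expected volume of a random simplex -/

/-- The matrix of edge vectors of a simplex at its vertex `x 0`. -/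
def edgeMatrix {k : ℕ} (x : Fin (k + 1) → EuclideanSpace ℝ (Fin k)) : Matrix (Fin k) (Fin k) ℝ :=
  Matrix.of fun j i => x i.succ j - x 0 j

/-- A simplex is the image of a fixed one under an affine map whose linear part has the edge vectors
as columns. -/
theorem volume_convexHull_range {k : ℕ} (x : Fin (k + 1) → EuclideanSpace ℝ (Fin k)) :
    volume (convexHull ℝ (range x)) = ENNReal.ofReal |(edgeMatrix x).det| *
      volume (convexHull ℝ (range (Fin.cons 0 (EuclideanSpace.basisFun (Fin k) ℝ) :
        Fin (k + 1) → EuclideanSpace ℝ (Fin k)))) := by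
  let b := (EuclideanSpace.basisFun (Fin k) ℝ).toBasis
  let L : EuclideanSpace ℝ (Fin k) →ₗ[ℝ] EuclideanSpace ℝ (Fin k) :=
    b.constr ℝ fun i => x i.succ - x 0
  have hL : ∀ i, L (EuclideanSpace.basisFun (Fin k) ℝ i) = x i.succ - x 0 := fun i => by
    have h := b.constr_basis ℝ (fun i => x i.succ - x 0) i
    rwa [OrthonormalBasis.coe_toBasis] at h
  have hdet : LinearMap.det L = (edgeMatrix x).det := by
    rw [← LinearMap.det_toMatrix b]
    congr 1
    ext j i
    rw [LinearMap.toMatrix_apply]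
    have : b i = EuclideanSpace.basisFun (Fin k) ℝ i := by simp [b]
    rw [this, hL]
    simp [b, edgeMatrix]
  let A : EuclideanSpace ℝ (Fin k) →ᵃ[ℝ] EuclideanSpace ℝ (Fin k) :=
    L.toAffineMap + AffineMap.const ℝ _ (x 0)
  have hA : range x = A '' range (Fin.cons 0 (EuclideanSpace.basisFun (Fin k) ℝ) :
      Fin (k + 1) → EuclideanSpace ℝ (Fin k)) := by
    rw [← range_comp]
    congr 1
    ext1 i
    refine Fin.cases ?_ (fun i => ?_) i
    · simp [A]
    · simp [A, hL, -EuclideanSpace.basisFun_apply]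
  rw [hA, ← AffineMap.image_convexHull]
  have hA' : ⇑A = (fun y => y + x 0) ∘ L := by
    ext1 y
    simp [A]
  rw [hA', image_comp, image_add_right, measure_preimage_add_right,
    Measure.addHaar_image_linearMap, hdet]

theorem continuous_volume_real_convexHull_range (k : ℕ) :
    Continuous fun x : Fin (k + 1) → EuclideanSpace ℝ (Fin k) =>
      volume.real (convexHull ℝ (range x)) := by
  have h : ∀ x : Fin (k + 1) → EuclideanSpace ℝ (Fin k), volume.real (convexHull ℝ (range x))
      = |(edgeMatrix x).det| * volume.real
        (convexHull ℝ (range (Fin.cons 0 (EuclideanSpace.basisFun (Fin k) ℝ) :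
          Fin (k + 1) → EuclideanSpace ℝ (Fin k)))) := fun x => by
    rw [Measure.real, volume_convexHull_range, ENNReal.toReal_mul,
      ENNReal.toReal_ofReal (abs_nonneg _)]
    rfl
  rw [funext h]
  refine Continuous.mul (Continuous.abs (Continuous.matrix_det ?_)) continuous_const
  refine continuous_matrix fun i j => ?_
  simp only [edgeMatrix, Matrix.of_apply]
  fun_prop

/-- The expected volume of the simplex spanned by `k + 1` independent uniform points in the unit
ball of dimension `k`. -/
noncomputable def ballSimplexVolume (k : ℕ) : ℝ :=
  ∫ x : Fin (k + 1) → EuclideanSpace ℝ (Fin k), volume.real (convexHull ℝ (range x))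
    ∂Measure.pi fun _ => volume[|unitBall k]

instance isProbabilityMeasure_cond_unitBall (k : ℕ) :
    IsProbabilityMeasure (volume[|unitBall k]) :=
  cond_isProbabilityMeasure_of_finite (volume_unitBall_ne_zero k) (volume_unitBall_ne_top k)

theorem ballSimplexVolume_pos (k : ℕ) : 0 < ballSimplexVolume k := by
  have hball : ∀ᵐ x ∂Measure.pi (fun _ : Fin (k + 1) => volume[|unitBall k]),
      ∀ i, x i ∈ unitBall k := by
    rw [ae_all_iff]
    intro i
    exact (measurePreserving_eval (fun _ : Fin (k + 1) => volume[|unitBall k]) i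
      ).quasiMeasurePreserving.ae (ae_cond_mem (measurableSet_unitBall k))
  have hint : Integrable (fun x : Fin (k + 1) → EuclideanSpace ℝ (Fin k) =>
      volume.real (convexHull ℝ (range x))) (Measure.pi fun _ => volume[|unitBall k]) := by
    refine Integrable.of_bound
      (continuous_volume_real_convexHull_range k).aestronglyMeasurable (ballVolume k) ?_
    filter_upwards [hball] with x hx
    rw [Real.norm_of_nonneg measureReal_nonneg]
    refine measureReal_mono (convexHull_min ?_ (convex_closedBall 0 1)) (volume_unitBall_ne_top k)
    rintro _ ⟨i, rfl⟩
    exact hx i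
  refine (integral_pos_iff_support_of_nonneg (fun x => measureReal_nonneg) hint).2 ?_
  have hae := ae_affineIndependent (μ := volume[|unitBall k]) (m := k + 1)
    (addHaar_affineSubspace_cond volume (unitBall k)) (by simp)
  have h1 : ∀ᵐ x ∂Measure.pi (fun _ : Fin (k + 1) => volume[|unitBall k]),
      x ∈ Function.support fun x : Fin (k + 1) → EuclideanSpace ℝ (Fin k) =>
        volume.real (convexHull ℝ (range x)) := by
    filter_upwards [hae] with x hx
    have htop : affineSpan ℝ (range x) = ⊤ :=
      hx.affineSpan_eq_top_iff_card_eq_finrank_add_one.2 (by simp)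
    have hint := interior_convexHull_nonempty_iff_affineSpan_eq_top.2 htop
    have hpos := Measure.measure_pos_of_nonempty_interior volume hint
    have hfin : volume (convexHull ℝ (range x)) ≠ ⊤ :=
      ((isBounded_convexHull.2 (finite_range x).isBounded).measure_lt_top).ne
    exact (ENNReal.toReal_pos hpos.ne' hfin).ne'
  have h2 : (Measure.pi fun _ : Fin (k + 1) => volume[|unitBall k])
      (Function.support fun x : Fin (k + 1) → EuclideanSpace ℝ (Fin k) =>
        volume.real (convexHull ℝ (range x))) = 1 :=
    prob_compl_eq_zero_iff₀ ?_ |>.1 (mem_ae_iff.1 h1)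
  · exact h2 ▸ one_pos
  · exact ((continuous_volume_real_convexHull_range k).measurable
      (measurableSet_singleton 0).compl).nullMeasurableSet

/-- The conditional measure on the image of a set under a similarity is the image of the
conditional measure. -/
theorem cond_image_eq_map {α β : Type*} [MeasurableSpace α] [MeasurableSpace β] {μ : Measure α}
    {ν : Measure β} {g : α → β} (hg : MeasurableEmbedding g) {c : ENNReal} (hc : c ≠ 0)
    (hc' : c ≠ ⊤) (h : ∀ S, ν (g '' S) = c * μ S) {S : Set α} (hS : MeasurableSet S) :
    ν[|g '' S] = (μ[|S]).map g := by
  ext A hA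
  rw [hg.map_apply, cond_apply (hg.measurableSet_image' hS), cond_apply hS,
    ← image_inter_preimage, h, h, ENNReal.mul_inv (Or.inl hc) (Or.inl hc')]
  rw [mul_mul_mul_comm, ENNReal.inv_mul_cancel hc hc', one_mul]

theorem expectedSimplexVolume_eq {k : ℕ} {u : EuclideanSpace ℝ (Fin (k + 1))} (hu : ‖u‖ = 1)
    {t : ℝ} (ht : t ∈ Ioo (-1 : ℝ) 1) :
    expectedSimplexVolume u t = √(1 - t ^ 2) ^ k * ballSimplexVolume k := by
  obtain ⟨V, hV, hr⟩ := exists_linearIsometry_range_eq_hyperplane hu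
  have ht' : 0 < 1 - t ^ 2 := by nlinarith [ht.1, ht.2]
  set r := √(1 - t ^ 2) with hrdef
  have hr0 : 0 < r := Real.sqrt_pos.2 ht'
  let g : EuclideanSpace ℝ (Fin k) →ᵃ[ℝ] EuclideanSpace ℝ (Fin (k + 1)) :=
    (r • V.toLinearMap).toAffineMap + AffineMap.const ℝ _ (t • u)
  have hg : ∀ y, g y = t • u + V (r • y) := fun y => by simp [g, add_comm]
  have hgc : ⇑g = (fun y => t • u + V y) ∘ (fun y => r • y) := funext hg
  have hginj : Function.Injective g := by
    rw [hgc]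
    exact (isometry_hyperplaneChart u V t).injective.comp (smul_right_injective _ hr0.ne')
  have hgcont : Continuous g := by
    rw [hgc]
    exact (isometry_hyperplaneChart u V t).continuous.comp (continuous_const_smul r)
  have himg : ∀ S : Set (EuclideanSpace ℝ (Fin k)),
      μHE[k] (g '' S) = ENNReal.ofReal (r ^ k) * volume S := by
    intro S
    rw [hgc, image_comp, (isometry_hyperplaneChart u V t).euclideanHausdorffMeasure_image,
      EuclideanSpace.euclideanHausdorffMeasure_eq_volume]
    have := Measure.addHaar_smul (volume : Measure (EuclideanSpace ℝ (Fin k))) r S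
    rw [finrank_euclideanSpace_fin, abs_of_pos (pow_pos hr0 k)] at this
    exact this
  have hset : hyperplane u t ∩ unitBall (k + 1) = g '' unitBall k := by
    rw [hyperplane_inter_unitBall_eq_image hu hV (hr t) (Ioo_subset_Icc_self ht), hgc, image_comp]
    congr 1
    change _ = (r • unitBall k : Set _)
    rw [unitBall, smul_closedBall _ _ zero_le_one, smul_zero, Real.norm_of_nonneg hr0.le, mul_one]
  have hemb : MeasurableEmbedding g := hgcont.measurable.measurableEmbedding hginj
  have hcond : μHE[k][|hyperplane u t ∩ unitBall (k + 1)] = (volume[|unitBall k]).map g := by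
    rw [hset]
    exact cond_image_eq_map hemb (ENNReal.ofReal_pos.2 (pow_pos hr0 k)).ne' ENNReal.ofReal_ne_top
      himg (measurableSet_unitBall k)
  have hprob : IsProbabilityMeasure ((volume[|unitBall k]).map g) :=
    Measure.isProbabilityMeasure_map hgcont.measurable.aemeasurable
  have hpi : Measure.pi (fun _ : Fin (k + 1) => (volume[|unitBall k]).map g)
      = (Measure.pi fun _ : Fin (k + 1) => volume[|unitBall k]).map fun x i => g (x i) :=
    (Measure.pi_map_pi fun _ => hgcont.measurable.aemeasurable).symm
  have hemb' : MeasurableEmbedding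
      fun (x : Fin (k + 1) → EuclideanSpace ℝ (Fin k)) i => g (x i) := by
    refine Measurable.measurableEmbedding (by fun_prop) fun x y hxy => funext fun i => ?_
    exact hginj (congrFun hxy i)
  unfold expectedSimplexVolume
  rw [Nat.add_sub_cancel]
  simp only [hcond]
  rw [hpi, hemb'.integral_map, ballSimplexVolume, ← integral_const_mul]
  congr 1
  ext x
  have : range (fun i => g (x i)) = g '' range x := range_comp g x
  rw [this, ← AffineMap.image_convexHull, Measure.real, himg, ENNReal.toReal_mul,
    ENNReal.toReal_ofReal (pow_pos hr0 k).le]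
  rfl

/-! ### The section function, its power and the profile -/

theorem sectionDensity_of_mem {k : ℕ} {u : EuclideanSpace ℝ (Fin (k + 1))} (hu : ‖u‖ = 1)
    {t : ℝ} (ht : t ∈ Icc (-1 : ℝ) 1) :
    sectionDensity u t
      = (ballVolume (k + 1))⁻¹ * ballVolume k * (1 - t ^ 2) ^ ((k : ℝ) / 2) := by
  rw [sectionDensity_eq_capDensity hu, capDensity_of_mem ht]

theorem inv_ballVolume_mul_ballVolume_pos (k : ℕ) :
    0 < (ballVolume (k + 1))⁻¹ * ballVolume k :=
  mul_pos (inv_pos.2 (ballVolume_pos _)) (ballVolume_pos _)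

theorem sectionDensity_rpow {k : ℕ} {u : EuclideanSpace ℝ (Fin (k + 1))} (hu : ‖u‖ = 1)
    {t : ℝ} (ht : t ∈ Icc (-1 : ℝ) 1) (p : ℝ) :
    sectionDensity u t ^ p = ((ballVolume (k + 1))⁻¹ * ballVolume k) ^ p *
      (1 - t ^ 2) ^ ((k : ℝ) / 2 * p) := by
  have ht' : 0 ≤ 1 - t ^ 2 := by nlinarith [ht.1, ht.2]
  rw [sectionDensity_of_mem hu ht, Real.mul_rpow (inv_ballVolume_mul_ballVolume_pos k).le
    (Real.rpow_nonneg ht' _), ← Real.rpow_mul ht']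

theorem sectionDensity_rpow_inv {k : ℕ} (hk : 1 ≤ k) {u : EuclideanSpace ℝ (Fin (k + 1))}
    (hu : ‖u‖ = 1) {t : ℝ} (ht : t ∈ Icc (-1 : ℝ) 1) :
    sectionDensity u t ^ (1 / (k : ℝ))
      = ((ballVolume (k + 1))⁻¹ * ballVolume k) ^ (1 / (k : ℝ)) * √(1 - t ^ 2) := by
  have hk' : (k : ℝ) ≠ 0 := by positivity
  rw [sectionDensity_rpow hu ht, Real.sqrt_eq_rpow]
  congr 2
  field_simp

theorem concaveOn_sqrt_one_sub_sq : ConcaveOn ℝ (Icc (-1 : ℝ) 1) fun t => √(1 - t ^ 2) := by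
  refine ⟨convex_Icc _ _, ?_⟩
  intro x hx y hy a b ha hb hab
  simp only [smul_eq_mul]
  have hx' : 0 ≤ 1 - x ^ 2 := by nlinarith [hx.1, hx.2]
  have hy' : 0 ≤ 1 - y ^ 2 := by nlinarith [hy.1, hy.2]
  have h1 := Real.strictConcaveOn_sqrt.concaveOn.2 hx' hy' ha hb hab
  simp only [smul_eq_mul] at h1
  refine h1.trans (Real.sqrt_le_sqrt ?_)
  have hb' : b = 1 - a := by linarith
  subst hb'
  nlinarith [mul_nonneg (mul_nonneg ha hb) (sq_nonneg (x - y))]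

theorem concaveOn_sectionDensity_rpow_inv {k : ℕ} (hk : 1 ≤ k)
    {u : EuclideanSpace ℝ (Fin (k + 1))} (hu : ‖u‖ = 1) :
    ConcaveOn ℝ (Icc (-1) 1) fun t => sectionDensity u t ^ (1 / (k : ℝ)) := by
  refine (concaveOn_sqrt_one_sub_sq.smul
    (Real.rpow_nonneg (inv_ballVolume_mul_ballVolume_pos k).le (1 / (k : ℝ)))).congr ?_
  intro t ht
  exact (sectionDensity_rpow_inv hk hu ht).symm

theorem expectedSimplexVolume_eq_mul_sectionDensity {k : ℕ} {u : EuclideanSpace ℝ (Fin (k + 1))}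
    (hu : ‖u‖ = 1) {t : ℝ} (ht : t ∈ Ioo (-1 : ℝ) 1) :
    expectedSimplexVolume u t
      = ballSimplexVolume k / ((ballVolume (k + 1))⁻¹ * ballVolume k) * sectionDensity u t := by
  have ht' : 0 ≤ 1 - t ^ 2 := by nlinarith [ht.1, ht.2]
  have h := inv_ballVolume_mul_ballVolume_pos k
  rw [expectedSimplexVolume_eq hu ht, sectionDensity_of_mem hu (Ioo_subset_Icc_self ht),
    Real.sqrt_eq_rpow, ← Real.rpow_mul_natCast ht', show (1 / 2 * (k : ℝ)) = k / 2 by ring,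
    ← mul_assoc, div_mul_cancel₀ _ h.ne', mul_comm]

theorem sectionQuantile_spec {k : ℕ} {u : EuclideanSpace ℝ (Fin (k + 1))} (hu : ‖u‖ = 1)
    {s : ℝ} (hs : s ∈ Icc (0 : ℝ) 1) :
    sectionQuantile u s ∈ Icc (-1 : ℝ) 1 ∧ capCdf k (sectionQuantile u s) = s := by
  have h : s ∈ sectionCdf u '' Icc (-1) 1 := by
    obtain ⟨t, ht, rfl⟩ := (bijOn_capCdf k).surjOn hs
    exact ⟨t, ht, sectionCdf_eq_capCdf hu t⟩
  refine ⟨Function.invFunOn_mem h, ?_⟩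
  rw [← sectionCdf_eq_capCdf hu]
  exact Function.invFunOn_eq h

theorem sectionProfile_eq {k : ℕ} (hk : 1 ≤ k) {u : EuclideanSpace ℝ (Fin (k + 1))}
    (hu : ‖u‖ = 1) {s : ℝ} (hs : s ∈ Icc (0 : ℝ) 1) :
    sectionProfile u s
      = (ballSimplexVolume k / ((ballVolume (k + 1))⁻¹ * ballVolume k)) ^ (1 / (k : ℝ))
        * sectionDensity u (sectionQuantile u s) ^ (((k : ℝ) + 1) / k) := by
  have hk' : (k : ℝ) ≠ 0 := by positivity
  have hk0 : 0 < (k : ℝ) := by positivity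
  have hcast : (((k + 1 : ℕ) : ℝ) - 1) = k := by push_cast; ring
  rw [sectionProfile, hcast]
  obtain ⟨hq, hqs⟩ := sectionQuantile_spec hu hs
  set q := sectionQuantile u s
  by_cases hq1 : q ∈ Ioo (-1 : ℝ) 1
  · have h1 : 0 < sectionDensity u q := by
      rw [sectionDensity_eq_capDensity hu]
      exact capDensity_pos hq1
    have h2 := div_pos (ballSimplexVolume_pos k) (inv_ballVolume_mul_ballVolume_pos k)
    rw [expectedSimplexVolume_eq_mul_sectionDensity hu hq1, Real.mul_rpow h2.le h1.le,
      mul_left_comm, add_div, div_self hk', Real.rpow_add h1, Real.rpow_one]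
  · -- At the end points of the support the section function vanishes.
    have hq2 : 1 - q ^ 2 = 0 := by
      rw [mem_Ioo, not_and_or, not_lt, not_lt] at hq1
      rcases hq1 with h | h
      · rw [le_antisymm h hq.1]
        norm_num
      · rw [le_antisymm hq.2 h]
        norm_num
    have h0 : sectionDensity u q = 0 := by
      rw [sectionDensity_of_mem hu hq, hq2, Real.zero_rpow (by positivity), mul_zero]
    rw [h0, zero_mul, Real.zero_rpow (by positivity), mul_zero]

theorem concaveOn_sectionProfile {k : ℕ} (hk : 1 ≤ k) {u : EuclideanSpace ℝ (Fin (k + 1))}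
    (hu : ‖u‖ = 1) : ConcaveOn ℝ (Icc 0 1) (sectionProfile u) := by
  have hk' : (k : ℝ) ≠ 0 := by positivity
  have h1 := div_pos (ballSimplexVolume_pos k) (inv_ballVolume_mul_ballVolume_pos k)
  have h2 := inv_ballVolume_mul_ballVolume_pos k
  refine ((concaveOn_comp_capCdf_inverse (k := k) (q := sectionQuantile u)
    fun s hs => sectionQuantile_spec hu hs).smul
    (mul_nonneg (Real.rpow_nonneg h1.le (1 / (k : ℝ)))
      (Real.rpow_nonneg h2.le (((k : ℝ) + 1) / k)))).congr ?_
  intro s hs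
  simp only [smul_eq_mul]
  rw [sectionProfile_eq hk hu hs, sectionDensity_rpow hu (sectionQuantile_spec hu hs).1, mul_assoc]
  congr 3
  field_simp

/-! ### Facets of a polytope with vertices in general position -/

section Facets

variable {E : Type*} [NormedAddCommGroup E] [NormedSpace ℝ E]

/-- If a linear functional is constant on `A` and smaller on `B`, then the points of the convex
hull of `A ∪ B` at which it is maximal form the convex hull of `A`. -/
theorem setOf_maximal_convexHull_union {A B : Set E} (hA : A.Nonempty) {l : E →L[ℝ] ℝ} {M : ℝ}
    (hlA : ∀ z ∈ A, l z = M) (hlB : ∀ z ∈ B, l z < M) :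
    {z ∈ convexHull ℝ (A ∪ B) | ∀ y ∈ convexHull ℝ (A ∪ B), l y ≤ l z} = convexHull ℝ A := by
  have hA' : ∀ z ∈ convexHull ℝ A, l z = M := fun z hz =>
    convexHull_min (t := {z | l z = M}) hlA (convex_hyperplane l.toLinearMap.isLinear M) hz
  have hB' : ∀ z ∈ convexHull ℝ B, l z < M := fun z hz =>
    convexHull_min (t := {z | l z < M}) hlB (convex_halfSpace_lt l.toLinearMap.isLinear M) hz
  have hAB : ∀ z ∈ convexHull ℝ (A ∪ B), l z ≤ M := fun z hz =>
    convexHull_min (t := {z | l z ≤ M})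
      (union_subset (fun z hz => (hlA z hz).le) fun z hz => (hlB z hz).le)
      (convex_halfSpace_le l.toLinearMap.isLinear M) hz
  have hsub : convexHull ℝ A ⊆ convexHull ℝ (A ∪ B) := convexHull_mono subset_union_left
  ext z
  constructor
  · rintro ⟨hz, hmax⟩
    rcases B.eq_empty_or_nonempty with rfl | hB
    · rwa [union_empty] at hz
    obtain ⟨a, ha⟩ := hA
    have hzM : M ≤ l z := hlA a ha ▸ hmax a (subset_convexHull ℝ _ (Or.inl ha))
    rw [convexHull_union ⟨a, ha⟩ hB, mem_convexJoin] at hz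
    obtain ⟨p, hp, q, hq, c, e, hc, he, hce, rfl⟩ := hz
    have hq' := hB' q hq
    rw [map_add, map_smul, map_smul, hA' p hp, smul_eq_mul, smul_eq_mul] at hzM
    have he0 : e = 0 := by
      have hc' : c = 1 - e := by linarith
      subst hc'
      nlinarith
    have hc1 : c = 1 := by linarith
    rwa [he0, hc1, one_smul, zero_smul, add_zero]
  · intro hz
    refine ⟨hsub hz, fun y hy => ?_⟩
    rw [hA' z hz]
    exact hAB y hy

theorem vectorSpan_convexHull (A : Set E) : vectorSpan ℝ (convexHull ℝ A) = vectorSpan ℝ A := by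
  rw [← direction_affineSpan, affineSpan_convexHull, direction_affineSpan]

/-- A set `I` of indices spans a facet of the convex hull of the points `x 0, …, x (n - 1)` in
general position if some linear functional is constant on the points with index in `I` and smaller
at the others. -/
def IsFacetIndex (x : ℕ → E) (n : ℕ) (I : Finset ℕ) : Prop :=
  ∃ (l : E →L[ℝ] ℝ) (M : ℝ), (∀ i ∈ I, l (x i) = M) ∧ ∀ i < n, i ∉ I → l (x i) < M

/-- A sequence of points is in general position in dimension `d` if any `d + 1` of its points are
affinely independent. -/
def InGeneralPosition (d : ℕ) (x : ℕ → E) : Prop :=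
  ∀ σ : Fin (d + 1) → ℕ, Function.Injective σ → AffineIndependent ℝ fun i => x (σ i)

theorem InGeneralPosition.affineIndependent {d : ℕ} {x : ℕ → E} (hx : InGeneralPosition d x)
    {I : Finset ℕ} (hI : I.card ≤ d + 1) : AffineIndependent ℝ fun i : I => x i := by
  obtain ⟨J, hIJ, hJ⟩ := Infinite.exists_superset_card_eq I (d + 1) hI
  have h := hx (fun i => J.orderEmbOfFin hJ i) (J.orderEmbOfFin hJ).injective
  have h2 : AffineIndependent ℝ fun i : J => x i :=
    (affineIndependent_equiv (J.orderIsoOfFin hJ).toEquiv).1 h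
  exact h2.comp_embedding (Function.Embedding.mk (fun i : I => (⟨i, hIJ i.2⟩ : J))
    fun i j hij => Subtype.ext (congrArg (fun j : J => (j : ℕ)) hij))

theorem InGeneralPosition.finrank_vectorSpan {d : ℕ} {x : ℕ → E} (hx : InGeneralPosition d x)
    {I : Finset ℕ} {m : ℕ} (hI : I.card = m + 1) (hm : m ≤ d) :
    Module.finrank ℝ (vectorSpan ℝ (x '' I)) = m := by
  rw [image_eq_range]
  exact (hx.affineIndependent (by omega)).finrank_vectorSpan (by simpa using hI)

/-- In general position, a set of points whose affine hull is a hyperplane has `d` elements. -/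
theorem InGeneralPosition.card_eq [FiniteDimensional ℝ E] {k : ℕ} {x : ℕ → E}
    (hx : InGeneralPosition (k + 1) x) {I : Finset ℕ} (hne : I.Nonempty)
    (hI : Module.finrank ℝ (vectorSpan ℝ (x '' I)) = k) : I.card = k + 1 := by
  have hpos := hne.card_pos
  rcases le_or_gt (k + 2) I.card with h | h
  · obtain ⟨J, hJI, hJ⟩ := Finset.exists_subset_card_eq h
    have h1 := hx.finrank_vectorSpan hJ le_rfl
    have h2 := Submodule.finrank_mono (vectorSpan_mono ℝ
      (image_mono (f := x) (Finset.coe_subset.2 hJI)))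
    omega
  · obtain ⟨m, hm⟩ : ∃ m, I.card = m + 1 := ⟨I.card - 1, by omega⟩
    have h1 := hx.finrank_vectorSpan hm (by omega)
    omega

open Classical in
theorem numFaces_convexHull_eq_card [FiniteDimensional ℝ E] {k : ℕ} {x : ℕ → E}
    (hx : InGeneralPosition (k + 1) x) (n : ℕ) :
    numFaces (convexHull ℝ (x '' Iio n)) k
      = (((Finset.range n).powersetCard (k + 1)).filter (IsFacetIndex x n)).card := by
  have hsplit : ∀ I ⊆ Finset.range n,
      x '' Iio n = x '' I ∪ x '' (Iio n \ I) := by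
    intro I hI
    rw [← image_union, union_sdiff_cancel]
    intro i hi
    exact Finset.mem_range.1 (hI hi)
  have himg : {F : Set E | F.Nonempty ∧ IsExposed ℝ (convexHull ℝ (x '' Iio n)) F ∧
      Module.finrank ℝ (vectorSpan ℝ F) = k}
      = (fun I : Finset ℕ => convexHull ℝ (x '' I)) ''
        (((Finset.range n).powersetCard (k + 1)).filter (IsFacetIndex x n) : Set (Finset ℕ)) := by
    ext F
    constructor
    · -- The vertices of an exposed face are the points at which the functional is maximal.
      rintro ⟨hne, hexp, hdim⟩
      obtain ⟨l, hl⟩ := hexp hne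
      obtain ⟨z, hz⟩ := hne
      have hz' := hz
      rw [hl] at hz'
      have hle : ∀ i < n, l (x i) ≤ l z := fun i hi =>
        hz'.2 _ (subset_convexHull ℝ _ ⟨i, hi, rfl⟩)
      let I := (Finset.range n).filter fun i => l (x i) = l z
      have hIsub : I ⊆ Finset.range n := Finset.filter_subset _ _
      have hlt : ∀ i < n, i ∉ I → l (x i) < l z := fun i hi hiI =>
        lt_of_le_of_ne (hle i hi) fun h =>
          hiI (Finset.mem_filter.2 ⟨Finset.mem_range.2 hi, h⟩)
      have hIne : I.Nonempty := by
        by_contra hemp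
        rw [Finset.not_nonempty_iff_eq_empty] at hemp
        have : convexHull ℝ (x '' Iio n) ⊆ {y | l y < l z} := by
          refine convexHull_min ?_ (convex_halfSpace_lt l.toLinearMap.isLinear _)
          rintro _ ⟨i, hi, rfl⟩
          exact hlt i hi (by simp [hemp])
        exact lt_irrefl (l z) (this hz'.1)
      have hF : F = convexHull ℝ (x '' I) := by
        rw [hl, hsplit I hIsub]
        refine setOf_maximal_convexHull_union (M := l z) (hIne.to_set.image x) ?_ ?_
        · rintro _ ⟨i, hi, rfl⟩
          exact (Finset.mem_filter.1 hi).2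
        · rintro _ ⟨i, ⟨hi, hiI⟩, rfl⟩
          exact hlt i hi hiI
      refine ⟨I, ?_, hF.symm⟩
      rw [hF, vectorSpan_convexHull] at hdim
      refine Finset.mem_coe.2 (Finset.mem_filter.2
        ⟨Finset.mem_powersetCard.2 ⟨hIsub, hx.card_eq hIne hdim⟩, l, l z, ?_, hlt⟩)
      exact fun i hi => (Finset.mem_filter.1 hi).2
    · rintro ⟨I, hI, rfl⟩
      obtain ⟨hI, l, M, hlI, hlc⟩ := Finset.mem_filter.1 (Finset.mem_coe.1 hI)
      obtain ⟨hIsub, hcard⟩ := Finset.mem_powersetCard.1 hI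
      have hIne : I.Nonempty := Finset.card_pos.1 (by omega)
      refine ⟨(hIne.to_set.image x).convexHull, fun _ => ⟨l, ?_⟩, ?_⟩
      · rw [hsplit I hIsub]
        refine (setOf_maximal_convexHull_union (M := M) (hIne.to_set.image x) ?_ ?_).symm
        · rintro _ ⟨i, hi, rfl⟩
          exact hlI i hi
        · rintro _ ⟨i, ⟨hi, hiI⟩, rfl⟩
          exact hlc i hi hiI
      · rw [vectorSpan_convexHull]
        exact hx.finrank_vectorSpan hcard (by omega)
  -- A facet determines the set of its vertices.
  have hinj : InjOn (fun I : Finset ℕ => convexHull ℝ (x '' I))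
      (((Finset.range n).powersetCard (k + 1)).filter (IsFacetIndex x n) : Set (Finset ℕ)) := by
    intro I hI J hJ hIJ
    obtain ⟨hI, l, M, hlI, hlc⟩ := Finset.mem_filter.1 (Finset.mem_coe.1 hI)
    obtain ⟨hIsub, hIcard⟩ := Finset.mem_powersetCard.1 hI
    obtain ⟨hJsub, hJcard⟩ :=
      Finset.mem_powersetCard.1 (Finset.mem_filter.1 (Finset.mem_coe.1 hJ)).1
    refine (Finset.eq_of_subset_of_card_le (fun j hj => ?_) (by omega)).symm
    by_contra hjI
    have h1 := hlc j (Finset.mem_range.1 (hJsub hj)) hjI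
    have h2 : x j ∈ convexHull ℝ (x '' I) := by
      have hIJ' : convexHull ℝ (x '' I) = convexHull ℝ (x '' J) := hIJ
      rw [hIJ']
      exact subset_convexHull ℝ _ ⟨j, hj, rfl⟩
    have h3 : l (x j) = M := convexHull_min (t := {z | l z = M})
      (by
        rintro _ ⟨i, hi, rfl⟩
        exact hlI i hi) (convex_hyperplane l.toLinearMap.isLinear M) h2
    exact h1.ne h3
  rw [numFaces, himg, hinj.ncard_image, ncard_coe_finset]

end Facets

/-! ### Points on a hyperplane in graph coordinates -/

/-- The matrix with rows `(1, y i)`; up to a factorial, the modulus of its determinant is the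
volume of the simplex with vertices `y i`. -/
def homogMatrix {k : ℕ} (y : Fin (k + 1) → Fin k → ℝ) : Matrix (Fin (k + 1)) (Fin (k + 1)) ℝ :=
  Matrix.of fun i => Fin.cons 1 (y i)

/-- The point above `y` on the graph of the affine function `y ↦ v 0 + ∑ j, v (j + 1) * y j`; the
coordinate with index `0` is the height. -/
def graphPoint {k : ℕ} (v : Fin (k + 1) → ℝ) (y : Fin k → ℝ) : EuclideanSpace ℝ (Fin (k + 1)) :=
  WithLp.toLp 2 (Fin.cons (v 0 + ∑ j, v j.succ * y j) y)

theorem homogMatrix_mulVec {k : ℕ} (y : Fin (k + 1) → Fin k → ℝ) (v : Fin (k + 1) → ℝ)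
    (i : Fin (k + 1)) : (homogMatrix y).mulVec v i = v 0 + ∑ j, v j.succ * y i j := by
  simp [homogMatrix, Matrix.mulVec, dotProduct, Fin.sum_univ_succ, mul_comm]

theorem continuous_det_homogMatrix (k : ℕ) :
    Continuous fun y : Fin (k + 1) → Fin k → ℝ => (homogMatrix y).det := by
  refine Continuous.matrix_det (continuous_matrix fun i j => ?_)
  refine Fin.cases ?_ (fun j => ?_) j
  · simp only [homogMatrix, Matrix.of_apply, Fin.cons_zero]
    fun_prop
  · simp only [homogMatrix, Matrix.of_apply, Fin.cons_succ]
    fun_prop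

theorem det_homogMatrix_ne_zero {k : ℕ} {y : Fin (k + 1) → Fin k → ℝ}
    (hy : AffineIndependent ℝ y) : (homogMatrix y).det ≠ 0 := by
  intro h
  obtain ⟨w, hw0, hw⟩ := Matrix.exists_vecMul_eq_zero_iff.2 h
  apply hw0
  have h1 : ∑ i, w i = 0 := by
    have := congrFun hw 0
    simpa [homogMatrix, Matrix.vecMul, dotProduct] using this
  have h2 : ∑ i, w i • y i = 0 := by
    ext j
    have := congrFun hw j.succ
    simpa [homogMatrix, Matrix.vecMul, dotProduct] using this
  ext i
  exact (affineIndependent_iff.1 hy) Finset.univ w h1 h2 i (Finset.mem_univ i)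

theorem ae_det_homogMatrix_ne_zero (k : ℕ) :
    ∀ᵐ y : Fin (k + 1) → Fin k → ℝ, (homogMatrix y).det ≠ 0 := by
  have h := ae_affineIndependent (μ := (volume : Measure (Fin k → ℝ))) (m := k + 1)
    (fun s hs => Measure.addHaar_affineSubspace volume s hs) (by simp)
  filter_upwards [h] with y hy using det_homogMatrix_ne_zero hy

theorem measurePreserving_heights (k : ℕ) :
    MeasurePreserving (fun x : Fin (k + 1) → Fin (k + 1) → ℝ =>
      ((fun i => x i 0, fun i j => x i j.succ) :
        (Fin (k + 1) → ℝ) × (Fin (k + 1) → Fin k → ℝ))) := by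
  have h1 := volume_preserving_pi (ι := Fin (k + 1))
    (f := fun _ => MeasurableEquiv.piFinSuccAbove (fun _ : Fin (k + 1) => ℝ) 0)
    (fun _ => volume_preserving_piFinSuccAbove (fun _ : Fin (k + 1) => ℝ) 0)
  exact (volume_measurePreserving_arrowProdEquivProdArrow ℝ (Fin k → ℝ) (Fin (k + 1))).comp h1

theorem lintegral_comp_mulVec {k : ℕ} {N : Matrix (Fin k) (Fin k) ℝ} (hN : N.det ≠ 0)
    {g : (Fin k → ℝ) → ENNReal} (hg : Measurable g) :
    ∫⁻ h, g h = ENNReal.ofReal |N.det| * ∫⁻ v, g (N.mulVec v) := by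
  have h1 := Real.map_matrix_volume_pi_eq_smul_volume_pi hN
  have hm : Measurable (Matrix.toLin' N) :=
    (LinearMap.continuous_of_finiteDimensional _).measurable
  have h2 : ∫⁻ v, g (N.mulVec v) = ENNReal.ofReal |N.det⁻¹| * ∫⁻ h, g h := by
    rw [← smul_eq_mul, ← lintegral_smul_measure, ← h1, lintegral_map hg hm]
    rfl
  rw [h2, ← mul_assoc, ← ENNReal.ofReal_mul (abs_nonneg _), ← abs_mul, mul_inv_cancel₀ hN]
  simp

/-- An affine Blaschke–Petkantschin formula in graph coordinates: `k + 1` points of the space of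
dimension `k + 1` are given by the affine function on whose graph they lie and by their
projections `y i`. For fixed projections the heights depend linearly on the coefficients of the
affine function. -/
theorem lintegral_points_eq_lintegral_graph {k : ℕ}
    {f : (Fin (k + 1) → EuclideanSpace ℝ (Fin (k + 1))) → ENNReal} (hf : Measurable f) :
    ∫⁻ x, f x ∂Measure.pi (fun _ => volume)
      = ∫⁻ v : Fin (k + 1) → ℝ, ∫⁻ y : Fin (k + 1) → Fin k → ℝ,
        ENNReal.ofReal |(homogMatrix y).det| * f fun i => graphPoint v (y i) := by
  have hp : MeasurePreserving
      (fun (x : Fin (k + 1) → Fin (k + 1) → ℝ) i => WithLp.toLp 2 (x i))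
      volume (Measure.pi fun _ => (volume : Measure (EuclideanSpace ℝ (Fin (k + 1))))) :=
    volume_preserving_pi fun _ => PiLp.volume_preserving_toLp (Fin (k + 1))
  let g : (Fin (k + 1) → ℝ) × (Fin (k + 1) → Fin k → ℝ) → ENNReal := fun p =>
    f fun i => WithLp.toLp 2 (Fin.cons (p.1 i) (p.2 i))
  have hcons : Measurable fun p : (Fin (k + 1) → ℝ) × (Fin (k + 1) → Fin k → ℝ) =>
      fun i => (WithLp.toLp 2 (Fin.cons (p.1 i) (p.2 i)) : EuclideanSpace ℝ (Fin (k + 1))) := by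
    refine measurable_pi_lambda _ fun i => (WithLp.measurable_toLp 2 _).comp ?_
    refine measurable_pi_lambda _ fun j => ?_
    refine Fin.cases ?_ (fun j => ?_) j
    · simp only [Fin.cons_zero]
      fun_prop
    · simp only [Fin.cons_succ]
      fun_prop
  have hg : Measurable g := hf.comp hcons
  have hgraph : Measurable fun p : (Fin (k + 1) → ℝ) × (Fin (k + 1) → Fin k → ℝ) =>
      ENNReal.ofReal |(homogMatrix p.2).det| * f fun i => graphPoint p.1 (p.2 i) := by
    refine Measurable.mul ?_ (hf.comp (measurable_pi_lambda _ fun i => ?_))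
    · exact (((continuous_det_homogMatrix k).comp continuous_snd).abs.measurable).ennreal_ofReal
    · refine (WithLp.measurable_toLp 2 _).comp (measurable_pi_lambda _ fun j => ?_)
      refine Fin.cases ?_ (fun j => ?_) j
      · simp only [Fin.cons_zero]
        fun_prop
      · simp only [Fin.cons_succ]
        fun_prop
  have hpre : ∀ x : Fin (k + 1) → Fin (k + 1) → ℝ,
      f (fun i => WithLp.toLp 2 (x i)) = g (fun i => x i 0, fun i j => x i j.succ) := by
    intro x
    simp only [g]
    congr 1
    ext i j
    refine Fin.cases ?_ (fun j => ?_) j <;> simp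
  rw [← hp.lintegral_comp hf]
  simp only [hpre]
  rw [(measurePreserving_heights k).lintegral_comp hg, Measure.volume_eq_prod,
    lintegral_prod_symm' _ hg]
  refine Eq.trans ?_ (lintegral_lintegral_swap
    (f := fun y v => ENNReal.ofReal |(homogMatrix y).det| * f fun i => graphPoint v (y i))
    (hgraph.comp measurable_swap).aemeasurable)
  refine lintegral_congr_ae ?_
  filter_upwards [ae_det_homogMatrix_ne_zero k] with y hy
  -- For fixed projections the heights are `homogMatrix y` applied to the coefficients.
  have hgy : Measurable fun h : Fin (k + 1) → ℝ => g (h, y) := by fun_prop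
  rw [lintegral_comp_mulVec hy hgy, lintegral_const_mul']
  · simp only [g, homogMatrix_mulVec]
    rfl
  · exact ENNReal.ofReal_ne_top

/-! ### Change of variables to the unit ball -/

theorem lintegral_comp_affine {k m : ℕ} {A : (Fin k → ℝ) →ₗ[ℝ] Fin k → ℝ}
    (hA : LinearMap.det A ≠ 0) (c : Fin k → ℝ) {G : (Fin m → Fin k → ℝ) → ENNReal}
    (hG : Measurable G) :
    ∫⁻ y, G y = ENNReal.ofReal (|LinearMap.det A| ^ m) *
      ∫⁻ y : Fin m → Fin k → ℝ, G fun i => c + A (y i) := by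
  let L : (Fin m → Fin k → ℝ) →ₗ[ℝ] Fin m → Fin k → ℝ :=
    LinearMap.pi fun i => A.comp (LinearMap.proj i)
  have hL : LinearMap.det L = LinearMap.det A ^ m := by
    rw [LinearMap.det_pi fun _ : Fin m => A]
    simp
  have hL0 : LinearMap.det L ≠ 0 := by
    rw [hL]
    exact pow_ne_zero _ hA
  have hm : Measurable L := (LinearMap.continuous_of_finiteDimensional _).measurable
  have h1 := Measure.map_linearMap_addHaar_eq_smul_addHaar
    (volume : Measure (Fin m → Fin k → ℝ)) hL0
  have hadd : Measurable fun y : Fin m → Fin k → ℝ => G ((fun _ => c) + y) :=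
    hG.comp (measurable_const_add _)
  have h2 : ∫⁻ y : Fin m → Fin k → ℝ, G (fun i => c + A (y i))
      = ENNReal.ofReal |(LinearMap.det L)⁻¹| * ∫⁻ y, G y := by
    rw [← lintegral_add_left_eq_self G (fun _ => c), ← smul_eq_mul, ← lintegral_smul_measure,
      ← h1, lintegral_map hadd hm]
    rfl
  rw [h2, ← mul_assoc, ← ENNReal.ofReal_mul (by positivity), ← abs_pow, ← hL, ← abs_mul,
    mul_inv_cancel₀ hL0]
  simp

theorem det_homogMatrix_affine {k : ℕ} (A : (Fin k → ℝ) →ₗ[ℝ] Fin k → ℝ) (c : Fin k → ℝ)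
    (y : Fin (k + 1) → Fin k → ℝ) :
    (homogMatrix fun i => c + A (y i)).det = (homogMatrix y).det * LinearMap.det A := by
  let T : Matrix (Fin (k + 1)) (Fin (k + 1)) ℝ :=
    Matrix.of (Fin.cons (Fin.cons 1 c) fun j => Fin.cons 0 fun l => A (Pi.single j 1) l)
  have hT : T.det = LinearMap.det A := by
    rw [Matrix.det_succ_column_zero, Fin.sum_univ_succ]
    have h0 : ∀ i : Fin k, T i.succ 0 = 0 := fun i => by simp [T]
    have h00 : T 0 0 = 1 := by simp [T]
    simp only [h0, h00, mul_zero, zero_mul, Finset.sum_const_zero, add_zero]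
    rw [← LinearMap.det_toMatrix', ← Matrix.det_transpose (LinearMap.toMatrix' A)]
    simp only [Fin.val_zero, pow_zero, one_mul]
    congr 1
  have hmul : homogMatrix (fun i => c + A (y i)) = homogMatrix y * T := by
    ext i l
    rw [Matrix.mul_apply, Fin.sum_univ_succ]
    refine Fin.cases ?_ (fun l => ?_) l
    · simp [homogMatrix, T]
    · have hy : A (y i) l = ∑ j, y i j * A (Pi.single j 1) l := by
        conv_lhs => rw [pi_eq_sum_univ' (y i)]
        simp [map_sum, Finset.sum_apply]
      simp [homogMatrix, T, hy]
  rw [hmul, Matrix.det_mul, hT]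

/-! ### Hyperplanes in graph coordinates -/

/-- The normal vector of the graph with coefficients `v`. -/
def graphNormal {k : ℕ} (v : Fin (k + 1) → ℝ) : EuclideanSpace ℝ (Fin (k + 1)) :=
  WithLp.toLp 2 (Fin.cons 1 fun j => -v j.succ)

theorem inner_graphNormal {k : ℕ} (v : Fin (k + 1) → ℝ) (z : EuclideanSpace ℝ (Fin (k + 1))) :
    inner ℝ z (graphNormal v) = z 0 - ∑ j : Fin k, v j.succ * z j.succ := by
  simp [graphNormal, PiLp.inner_apply, Fin.sum_univ_succ, sub_eq_add_neg]

theorem inner_graphPoint_graphNormal {k : ℕ} (v : Fin (k + 1) → ℝ) (y : Fin k → ℝ) :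
    inner ℝ (graphPoint v y) (graphNormal v) = v 0 := by
  simp [inner_graphNormal, graphPoint]

theorem norm_graphNormal_sq {k : ℕ} (v : Fin (k + 1) → ℝ) :
    ‖graphNormal v‖ ^ 2 = 1 + ∑ j : Fin k, v j.succ ^ 2 := by
  simp [EuclideanSpace.norm_sq_eq, graphNormal, Fin.sum_univ_succ]

theorem norm_graphNormal_pos {k : ℕ} (v : Fin (k + 1) → ℝ) : 0 < ‖graphNormal v‖ := by
  refine norm_pos_iff.2 fun h => ?_
  have h1 := norm_graphNormal_sq v
  rw [h, norm_zero] at h1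
  have : 0 ≤ ∑ j : Fin k, v j.succ ^ 2 := Finset.sum_nonneg fun _ _ => sq_nonneg _
  linarith

theorem graphPoint_mem_unitBall_iff {k : ℕ} (v : Fin (k + 1) → ℝ) (y : Fin k → ℝ) :
    graphPoint v y ∈ unitBall (k + 1)
      ↔ (v 0 + ∑ j, v j.succ * y j) ^ 2 + ∑ j, y j ^ 2 ≤ 1 := by
  rw [unitBall, mem_closedBall_zero_iff, ← sq_le_one_iff₀ (norm_nonneg _),
    EuclideanSpace.norm_sq_eq]
  simp [graphPoint, Fin.sum_univ_succ]

/-- The linear part of the affine map that takes the unit ball to the projection of the section of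
the ball with the graph with coefficients `v`: up to the factor `r`, a contraction by the factor
`‖graphNormal v‖` in the direction of the slope. -/
noncomputable def sectionMap {k : ℕ} (v : Fin (k + 1) → ℝ) (r : ℝ) :
    (Fin k → ℝ) →ₗ[ℝ] Fin k → ℝ :=
  r • LinearMap.transvection
    ((-(‖graphNormal v‖ * (‖graphNormal v‖ + 1))⁻¹) • Fintype.linearCombination ℝ
      (fun j => v (Fin.succ j))) fun j => v j.succ

theorem sectionMap_apply {k : ℕ} (v : Fin (k + 1) → ℝ) (r : ℝ) (y : Fin k → ℝ) (j : Fin k) :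
    sectionMap v r y j = r * (y j - (‖graphNormal v‖ * (‖graphNormal v‖ + 1))⁻¹ *
      (∑ i, v i.succ * y i) * v j.succ) := by
  simp [sectionMap, LinearMap.transvection.apply, Fintype.linearCombination_apply, mul_comm,
    sub_eq_add_neg]

theorem det_sectionMap {k : ℕ} (v : Fin (k + 1) → ℝ) (r : ℝ) :
    LinearMap.det (sectionMap v r) = r ^ k / ‖graphNormal v‖ := by
  have hw := norm_graphNormal_pos v
  have h := norm_graphNormal_sq v
  rw [sectionMap, LinearMap.det_smul, LinearMap.transvection.det, Module.finrank_fin_fun]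
  have : (Fintype.linearCombination ℝ fun j : Fin k => v j.succ) (fun j => v j.succ)
      = ‖graphNormal v‖ ^ 2 - 1 := by
    rw [h]
    simp [Fintype.linearCombination_apply, pow_two]
  rw [LinearMap.smul_apply, this, smul_eq_mul]
  field_simp
  ring

theorem graphPoint_sectionMap_mem_unitBall_iff {k : ℕ} (v : Fin (k + 1) → ℝ) {r : ℝ}
    (hr : 0 < r) (hr2 : r ^ 2 = 1 - (v 0 / ‖graphNormal v‖) ^ 2) (y : Fin k → ℝ) :
    graphPoint v ((fun j => -(v 0 / ‖graphNormal v‖ ^ 2) * v j.succ) + sectionMap v r y)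
        ∈ unitBall (k + 1)
      ↔ graphPoint 0 y ∈ unitBall (k + 1) := by
  have hw := norm_graphNormal_pos v
  have hβ : ∑ j : Fin k, v j.succ ^ 2 = ‖graphNormal v‖ ^ 2 - 1 := by
    rw [norm_graphNormal_sq]
    ring
  rw [graphPoint_mem_unitBall_iff, graphPoint_mem_unitBall_iff]
  set w := ‖graphNormal v‖
  set s := ∑ i : Fin k, v i.succ * y i with hs
  set g := (w * (w + 1))⁻¹ with hg
  have hgw : g * (w * (w + 1)) = 1 := inv_mul_cancel₀ (by positivity)
  have h1 : ∑ j : Fin k, v j.succ *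
      ((fun j => -(v 0 / w ^ 2) * v j.succ) + sectionMap v r y : Fin k → ℝ) j
      = -(v 0 / w ^ 2) * (w ^ 2 - 1) + r * (s - g * s * (w ^ 2 - 1)) := by
    have : ∀ j : Fin k, v j.succ *
        ((fun j => -(v 0 / w ^ 2) * v j.succ) + sectionMap v r y : Fin k → ℝ) j
        = (-(v 0 / w ^ 2) - r * (g * s)) * v j.succ ^ 2 + r * (v j.succ * y j) := by
      intro j
      simp only [Pi.add_apply, sectionMap_apply]
      rw [← hs]
      ring
    simp only [this, Finset.sum_add_distrib, ← Finset.mul_sum, hβ, ← hs]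
    ring
  have h2 : ∑ j : Fin k,
      (((fun j => -(v 0 / w ^ 2) * v j.succ) + sectionMap v r y : Fin k → ℝ) j) ^ 2
      = (v 0 / w ^ 2) ^ 2 * (w ^ 2 - 1) - 2 * (v 0 / w ^ 2) * (r * (s - g * s * (w ^ 2 - 1)))
        + r ^ 2 * (∑ j, y j ^ 2 - 2 * g * s * s + g ^ 2 * s ^ 2 * (w ^ 2 - 1)) := by
    have : ∀ j : Fin k,
        (((fun j => -(v 0 / w ^ 2) * v j.succ) + sectionMap v r y : Fin k → ℝ) j) ^ 2
        = ((v 0 / w ^ 2) ^ 2 + 2 * (v 0 / w ^ 2) * r * (g * s) + r ^ 2 * (g ^ 2 * s ^ 2))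
            * v j.succ ^ 2
          + (-(2 * (v 0 / w ^ 2) * r) - r ^ 2 * (2 * g * s)) * (v j.succ * y j)
          + r ^ 2 * y j ^ 2 := by
      intro j
      simp only [Pi.add_apply, sectionMap_apply]
      rw [← hs]
      ring
    simp only [this, Finset.sum_add_distrib, ← Finset.mul_sum, hβ, ← hs]
    ring
  -- With `h = v 0 / w`, the squared norm of the lifted point becomes `h ^ 2 + r ^ 2 * ‖y‖ ^ 2`.
  have h3 : (v 0 + ∑ j : Fin k, v j.succ *
        ((fun j => -(v 0 / w ^ 2) * v j.succ) + sectionMap v r y : Fin k → ℝ) j) ^ 2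
      + ∑ j : Fin k,
        (((fun j => -(v 0 / w ^ 2) * v j.succ) + sectionMap v r y : Fin k → ℝ) j) ^ 2
      = 1 - r ^ 2 + r ^ 2 * ∑ j, y j ^ 2 := by
    rw [h1, h2, show (1 : ℝ) - r ^ 2 = (v 0 / w) ^ 2 by rw [hr2]; ring, hg]
    field_simp
    ring
  rw [h3]
  have hr2' : 0 < r ^ 2 := by positivity
  simp only [Pi.zero_apply, zero_mul, Finset.sum_const_zero, add_zero, ne_eq, OfNat.ofNat_ne_zero,
    not_false_eq_true, zero_pow, zero_add]
  constructor
  · intro h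
    nlinarith
  · intro h
    nlinarith

theorem graphPoint_notMem_unitBall {k : ℕ} {v : Fin (k + 1) → ℝ}
    (hv : 1 < |v 0 / ‖graphNormal v‖|) (y : Fin k → ℝ) :
    graphPoint v y ∉ unitBall (k + 1) := by
  intro h
  rw [unitBall, mem_closedBall_zero_iff] at h
  have hw := norm_graphNormal_pos v
  have h1 := abs_real_inner_le_norm (graphPoint v y) (graphNormal v)
  rw [inner_graphPoint_graphNormal] at h1
  rw [abs_div, abs_of_pos hw, one_lt_div hw] at hv
  nlinarith

/-- The moment of order one of the simplex volume over the points whose lifts to the graph with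
coefficients `v` lie in the ball. -/
noncomputable def graphMoment (k : ℕ) (v : Fin (k + 1) → ℝ) : ENNReal :=
  ∫⁻ y : Fin (k + 1) → Fin k → ℝ, ENNReal.ofReal |(homogMatrix y).det| *
    {y : Fin (k + 1) → Fin k → ℝ | ∀ i, graphPoint v (y i) ∈ unitBall (k + 1)}.indicator 1 y

theorem continuous_graphPoint (k : ℕ) :
    Continuous fun p : (Fin (k + 1) → ℝ) × (Fin k → ℝ) => graphPoint p.1 p.2 := by
  refine (PiLp.continuous_toLp 2 _).comp (continuous_pi fun j => ?_)
  refine Fin.cases ?_ (fun j => ?_) j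
  · simp only [Fin.cons_zero]
    fun_prop
  · simp only [Fin.cons_succ]
    fun_prop

theorem measurableSet_forall_graphPoint_mem {k : ℕ} (v : Fin (k + 1) → ℝ) :
    MeasurableSet
      {y : Fin (k + 1) → Fin k → ℝ | ∀ i, graphPoint v (y i) ∈ unitBall (k + 1)} := by
  refine IsClosed.measurableSet ?_
  simp only [ofPred_forall]
  refine isClosed_iInter fun i => Metric.isClosed_closedBall.preimage ?_
  exact (continuous_graphPoint k).comp
    (continuous_const.prodMk (continuous_apply i))

/-- For a hyperplane at distance `|h| < 1` from the origin, the moment is determined by the volume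
of the section, since an affine map takes the unit ball to its projection. -/
theorem graphMoment_eq {k : ℕ} {v : Fin (k + 1) → ℝ} (hv : |v 0 / ‖graphNormal v‖| < 1) :
    graphMoment k v = ENNReal.ofReal
      ((√(1 - (v 0 / ‖graphNormal v‖) ^ 2) ^ k / ‖graphNormal v‖) ^ (k + 2)) * graphMoment k 0 := by
  have hw := norm_graphNormal_pos v
  have hpos : 0 < 1 - (v 0 / ‖graphNormal v‖) ^ 2 := by
    rw [sub_pos, sq_lt_one_iff_abs_lt_one]
    exact hv
  set r := √(1 - (v 0 / ‖graphNormal v‖) ^ 2) with hr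
  have hr0 : 0 < r := Real.sqrt_pos.2 hpos
  have hr2 : r ^ 2 = 1 - (v 0 / ‖graphNormal v‖) ^ 2 := Real.sq_sqrt hpos.le
  have hD : 0 < r ^ k / ‖graphNormal v‖ := by positivity
  have hdet := det_sectionMap v r
  rw [graphMoment, lintegral_comp_affine (A := sectionMap v r) (by rw [hdet]; exact hD.ne')
    (fun j => -(v 0 / ‖graphNormal v‖ ^ 2) * v j.succ), hdet, abs_of_pos hD]
  · have : ∀ y : Fin (k + 1) → Fin k → ℝ,
        ENNReal.ofReal |(homogMatrix fun i => (fun j => -(v 0 / ‖graphNormal v‖ ^ 2) * v j.succ) +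
            sectionMap v r (y i)).det| *
          {y : Fin (k + 1) → Fin k → ℝ | ∀ i, graphPoint v (y i) ∈ unitBall (k + 1)}.indicator 1
            (fun i => (fun j => -(v 0 / ‖graphNormal v‖ ^ 2) * v j.succ) + sectionMap v r (y i))
        = ENNReal.ofReal (r ^ k / ‖graphNormal v‖) * (ENNReal.ofReal |(homogMatrix y).det| *
          {y : Fin (k + 1) → Fin k → ℝ | ∀ i, graphPoint 0 (y i) ∈ unitBall (k + 1)}.indicator 1
            y) := by
      intro y
      rw [det_homogMatrix_affine, abs_mul, hdet, abs_of_pos hD,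
        mul_comm |(homogMatrix y).det|, ENNReal.ofReal_mul hD.le, mul_assoc]
      congr 2
      classical
      simp only [indicator, mem_ofPred_eq, Pi.one_apply]
      exact if_congr (forall_congr' fun i =>
        graphPoint_sectionMap_mem_unitBall_iff v hr0 hr2 (y i)) rfl rfl
    simp only [this]
    rw [lintegral_const_mul' _ _ ENNReal.ofReal_ne_top, ← mul_assoc,
      ← ENNReal.ofReal_mul (by positivity), ← pow_succ]
    rfl
  · exact (continuous_det_homogMatrix k).abs.measurable.ennreal_ofReal.mul
      (measurable_one.indicator (measurableSet_forall_graphPoint_mem v))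

theorem graphMoment_eq_zero {k : ℕ} {v : Fin (k + 1) → ℝ} (hv : 1 < |v 0 / ‖graphNormal v‖|) :
    graphMoment k v = 0 := by
  have : ∀ y : Fin (k + 1) → Fin k → ℝ,
      {y : Fin (k + 1) → Fin k → ℝ | ∀ i, graphPoint v (y i) ∈ unitBall (k + 1)}.indicator
        (1 : (Fin (k + 1) → Fin k → ℝ) → ENNReal) y = 0 := fun y =>
    indicator_of_notMem
      (fun h : ∀ i, graphPoint v (y i) ∈ unitBall (k + 1) =>
        graphPoint_notMem_unitBall hv (y 0) (h 0)) _
  simp [graphMoment, this]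

/-! ### The two sides of a random hyperplane -/

/-- A function of `z` that vanishes on the hyperplane through the points `x i` and whose sign tells
the two sides of it apart: by Cramer's rule, the determinant of the projections times the height
of `z` above the hyperplane. -/
noncomputable def sideFun {k : ℕ} (x : Fin (k + 1) → EuclideanSpace ℝ (Fin (k + 1)))
    (z : EuclideanSpace ℝ (Fin (k + 1))) : ℝ :=
  (homogMatrix fun i j => x i j.succ).det * z 0 -
    ∑ l, ((homogMatrix fun i j => x i j.succ).adjugate.mulVec fun i => x i 0) l *
      (Fin.cons 1 (fun j : Fin k => z j.succ) : Fin (k + 1) → ℝ) l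

theorem continuous_homogMatrix (k : ℕ) :
    Continuous fun y : Fin (k + 1) → Fin k → ℝ => homogMatrix y := by
  refine continuous_matrix fun i j => ?_
  refine Fin.cases ?_ (fun j => ?_) j
  · simp only [homogMatrix, Matrix.of_apply, Fin.cons_zero]
    fun_prop
  · simp only [homogMatrix, Matrix.of_apply, Fin.cons_succ]
    fun_prop

theorem continuous_sideFun (k : ℕ) :
    Continuous fun p : (Fin (k + 1) → EuclideanSpace ℝ (Fin (k + 1))) ×
      EuclideanSpace ℝ (Fin (k + 1)) => sideFun p.1 p.2 := by
  have h0 : Continuous fun p : (Fin (k + 1) → EuclideanSpace ℝ (Fin (k + 1))) ×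
      EuclideanSpace ℝ (Fin (k + 1)) => homogMatrix fun i j => p.1 i j.succ :=
    (continuous_homogMatrix k).comp (by fun_prop)
  have h1 : Continuous fun p : (Fin (k + 1) → EuclideanSpace ℝ (Fin (k + 1))) ×
      EuclideanSpace ℝ (Fin (k + 1)) =>
        (homogMatrix fun i j => p.1 i j.succ).adjugate.mulVec fun i => p.1 i 0 :=
    h0.matrix_adjugate.matrix_mulVec (by fun_prop)
  have h2 : Continuous fun p : (Fin (k + 1) → EuclideanSpace ℝ (Fin (k + 1))) ×
      EuclideanSpace ℝ (Fin (k + 1)) =>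
        (Fin.cons 1 (fun j : Fin k => p.2 j.succ) : Fin (k + 1) → ℝ) := by
    refine continuous_pi fun j => ?_
    refine Fin.cases ?_ (fun j => ?_) j
    · simp only [Fin.cons_zero]
      fun_prop
    · simp only [Fin.cons_succ]
      fun_prop
  refine (h0.matrix_det.mul (by fun_prop)).sub (continuous_finsetSum _ fun l _ => ?_)
  exact ((continuous_apply l).comp h1).mul ((continuous_apply l).comp h2)

theorem sideFun_graphPoint {k : ℕ} (v : Fin (k + 1) → ℝ) (y : Fin (k + 1) → Fin k → ℝ)
    (z : EuclideanSpace ℝ (Fin (k + 1))) :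
    sideFun (fun i => graphPoint v (y i)) z
      = (homogMatrix y).det * (inner ℝ z (graphNormal v) - v 0) := by
  have h1 : (fun i j => graphPoint v (y i) (Fin.succ j)) = y := by
    ext i j
    simp [graphPoint]
  have h2 : (fun i => graphPoint v (y i) 0) = (homogMatrix y).mulVec v := by
    ext i
    rw [homogMatrix_mulVec]
    simp [graphPoint]
  rw [sideFun, h1, h2, Matrix.mulVec_mulVec, Matrix.adjugate_mul, inner_graphNormal,
    Fin.sum_univ_succ]
  simp only [Matrix.smul_mulVec, Matrix.one_mulVec, Pi.smul_apply, smul_eq_mul, Fin.cons_zero,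
    Fin.cons_succ, mul_one, mul_assoc, ← Finset.mul_sum]
  ring

theorem exists_eq_graphPoint {k : ℕ} {x : Fin (k + 1) → EuclideanSpace ℝ (Fin (k + 1))}
    (hx : (homogMatrix fun i j => x i j.succ).det ≠ 0) :
    ∃ v : Fin (k + 1) → ℝ, x = fun i => graphPoint v fun j => x i j.succ := by
  set N := homogMatrix fun i j => x i j.succ with hN
  refine ⟨N⁻¹.mulVec fun i => x i 0, ?_⟩
  have h : N.mulVec (N⁻¹.mulVec fun i => x i 0) = fun i => x i 0 := by
    rw [Matrix.mulVec_mulVec, Matrix.mul_nonsing_inv _ (isUnit_iff_ne_zero.2 hx),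
      Matrix.one_mulVec]
  ext i l
  have hi := congrFun h i
  rw [hN, homogMatrix_mulVec, ← hN] at hi
  refine Fin.cases ?_ (fun l => ?_) l
  · simp only [graphPoint, Fin.cons_zero]
    exact hi.symm
  · simp [graphPoint]

/-- A uniform point of the ball lies below a hyperplane with the probability `capCdf`. -/
theorem cond_unitBall_lt {k : ℕ} {u : EuclideanSpace ℝ (Fin (k + 1))} (hu : ‖u‖ = 1) (t : ℝ) :
    volume[|unitBall (k + 1)] {z | inner ℝ z u < t} = ENNReal.ofReal (capCdf k t) := by
  rw [cond_apply (measurableSet_unitBall _), volume_unitBall_inter_lt hu,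
    ENNReal.ofReal_mul (ballVolume_pos _).le, ofReal_ballVolume, ← mul_assoc,
    ENNReal.inv_mul_cancel (volume_unitBall_ne_zero _) (volume_unitBall_ne_top _), one_mul]

theorem cond_unitBall_graph_lt {k : ℕ} (v : Fin (k + 1) → ℝ) :
    volume[|unitBall (k + 1)] {z | inner ℝ z (graphNormal v) < v 0}
      = ENNReal.ofReal (capCdf k (v 0 / ‖graphNormal v‖)) := by
  have hw := norm_graphNormal_pos v
  have hu : ‖(‖graphNormal v‖⁻¹ • graphNormal v)‖ = 1 := by
    rw [norm_smul, norm_inv, norm_norm, inv_mul_cancel₀ hw.ne']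
  rw [← cond_unitBall_lt hu]
  congr 1
  ext z
  rw [mem_ofPred_eq, mem_ofPred_eq, inner_smul_right, lt_div_iff₀ hw, mul_comm,
    mul_inv_cancel_left₀ hw.ne']

theorem cond_unitBall_graph_gt {k : ℕ} (v : Fin (k + 1) → ℝ) :
    volume[|unitBall (k + 1)] {z | v 0 < inner ℝ z (graphNormal v)}
      = ENNReal.ofReal (capCdf k (-(v 0 / ‖graphNormal v‖))) := by
  have hw := norm_graphNormal_pos v
  have hu : ‖(-‖graphNormal v‖⁻¹) • graphNormal v‖ = 1 := by
    rw [norm_smul, norm_neg, norm_inv, norm_norm, inv_mul_cancel₀ hw.ne']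
  rw [← cond_unitBall_lt hu]
  congr 1
  ext z
  rw [mem_ofPred_eq, mem_ofPred_eq, inner_smul_right, neg_mul, neg_lt_neg_iff, div_lt_iff₀ hw,
    mul_comm, mul_inv_cancel_left₀ hw.ne']

/-- The sum of the probabilities that `m` independent uniform points of the ball all lie strictly
on one given side of the hyperplane through the points `x i`. -/
noncomputable def sideProb {k : ℕ} (m : ℕ) (x : Fin (k + 1) → EuclideanSpace ℝ (Fin (k + 1))) :
    ENNReal :=
  volume[|unitBall (k + 1)] {z | 0 < sideFun x z} ^ m
    + volume[|unitBall (k + 1)] {z | sideFun x z < 0} ^ m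

theorem measurable_sideProb (k m : ℕ) :
    Measurable (sideProb (k := k) m) := by
  have h1 := measurable_measure_prodMk_left (ν := volume[|unitBall (k + 1)])
    (isOpen_lt (continuous_const (y := (0 : ℝ))) (continuous_sideFun k)).measurableSet
  have h2 := measurable_measure_prodMk_left (ν := volume[|unitBall (k + 1)])
    (isOpen_lt (continuous_sideFun k) (continuous_const (y := (0 : ℝ)))).measurableSet
  exact (h1.pow_const m).add (h2.pow_const m)

/-- The value of `sideProb` for a hyperplane at signed distance `h` from the origin. -/
noncomputable def capPow (k m : ℕ) (h : ℝ) : ENNReal :=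
  ENNReal.ofReal (capCdf k h) ^ m + ENNReal.ofReal (capCdf k (-h)) ^ m

theorem measurable_capPow (k m : ℕ) : Measurable (capPow k m) :=
  ((continuous_capCdf k).measurable.ennreal_ofReal.pow_const m).add
    (((continuous_capCdf k).comp continuous_neg).measurable.ennreal_ofReal.pow_const m)

theorem sideProb_graphPoint {k : ℕ} (m : ℕ) (v : Fin (k + 1) → ℝ)
    {y : Fin (k + 1) → Fin k → ℝ} (hy : (homogMatrix y).det ≠ 0) :
    sideProb m (fun i => graphPoint v (y i)) = capPow k m (v 0 / ‖graphNormal v‖) := by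
  rw [sideProb, capPow, ← cond_unitBall_graph_lt, ← cond_unitBall_graph_gt]
  simp only [sideFun_graphPoint]
  rcases lt_or_gt_of_ne hy with h | h
  · simp only [mul_pos_iff, mul_neg_iff, h, h.not_gt, sub_pos, sub_neg, true_and,
      false_and, false_or]
  · rw [add_comm]
    simp only [mul_pos_iff, mul_neg_iff, h, h.not_gt, sub_pos, sub_neg, true_and,
      false_and, or_false]

/-- The expectation of `sideProb` over independent uniform points of the ball. -/
noncomputable def expectedSideProb (k m : ℕ) : ENNReal :=
  ∫⁻ x, sideProb m x ∂Measure.pi fun _ : Fin (k + 1) => volume[|unitBall (k + 1)]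

theorem pi_cond_unitBall (k m : ℕ) :
    Measure.pi (fun _ : Fin m => volume[|unitBall k])
      = (volume (unitBall k))⁻¹ ^ m •
        (Measure.pi fun _ : Fin m => volume).restrict (univ.pi fun _ => unitBall k) := by
  rw [Measure.restrict_pi_pi]
  refine Measure.pi_eq fun s _ => ?_
  rw [Measure.smul_apply, Measure.pi_pi, smul_eq_mul]
  simp [ProbabilityTheory.cond, Finset.prod_mul_distrib]

theorem norm_graphNormal_cons {k : ℕ} (a : ℝ) (b : Fin k → ℝ) :
    ‖graphNormal (Fin.cons a b : Fin (k + 1) → ℝ)‖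
      = ‖graphNormal (Fin.cons 0 b : Fin (k + 1) → ℝ)‖ := by
  simp [graphNormal]

theorem measurable_graphMoment (k : ℕ) : Measurable (graphMoment k) := by
  refine Measurable.lintegral_prod_right'
    (f := fun p : (Fin (k + 1) → ℝ) × (Fin (k + 1) → Fin k → ℝ) =>
      ENNReal.ofReal |(homogMatrix p.2).det| *
        {y : Fin (k + 1) → Fin k → ℝ | ∀ i, graphPoint p.1 (y i) ∈ unitBall (k + 1)}.indicator
          (1 : (Fin (k + 1) → Fin k → ℝ) → ENNReal) p.2) ?_
  refine (((continuous_det_homogMatrix k).comp continuous_snd).abs.measurable.ennreal_ofReal).mul ?_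
  have hS : MeasurableSet {p : (Fin (k + 1) → ℝ) × (Fin (k + 1) → Fin k → ℝ) |
      ∀ i, graphPoint p.1 (p.2 i) ∈ unitBall (k + 1)} := by
    refine IsClosed.measurableSet ?_
    simp only [ofPred_forall]
    refine isClosed_iInter fun i => Metric.isClosed_closedBall.preimage ?_
    exact (continuous_graphPoint k).comp
      (continuous_fst.prodMk ((continuous_apply i).comp continuous_snd))
  exact (measurable_one (α := ENNReal)).indicator hS

theorem measurable_norm_graphNormal (k : ℕ) :
    Measurable fun v : Fin (k + 1) → ℝ => ‖graphNormal v‖ := by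
  refine Continuous.measurable (Continuous.norm ((PiLp.continuous_toLp 2 _).comp
    (continuous_pi fun j => ?_)))
  refine Fin.cases ?_ (fun j => ?_) j
  · simp only [Fin.cons_zero]
    fun_prop
  · simp only [Fin.cons_succ]
    fun_prop

/-- Up to a constant, the density of the signed distance from the origin of the hyperplane through
`k + 1` uniform points of the ball. -/
noncomputable def distDensity (k : ℕ) (h : ℝ) : ℝ :=
  (√(1 - h ^ 2) ^ k) ^ (k + 2)

theorem distDensity_nonneg (k : ℕ) (h : ℝ) : 0 ≤ distDensity k h := by
  unfold distDensity
  positivity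

theorem continuous_distDensity (k : ℕ) : Continuous (distDensity k) := by
  unfold distDensity
  fun_prop

theorem lintegral_comp_mul_pos {w : ℝ} (hw : 0 < w) {g : ℝ → ENNReal} (hg : Measurable g) :
    ∫⁻ a, g a = ENNReal.ofReal w * ∫⁻ h, g (w * h) := by
  have h1 := Real.map_volume_mul_left hw.ne'
  have h2 : ∫⁻ h, g (w * h) = ENNReal.ofReal |w⁻¹| * ∫⁻ a, g a := by
    rw [← smul_eq_mul, ← lintegral_smul_measure, ← h1, lintegral_map hg (measurable_const_mul w)]
  rw [h2, ← mul_assoc, ← ENNReal.ofReal_mul hw.le, abs_of_pos (inv_pos.2 hw),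
    mul_inv_cancel₀ hw.ne', ENNReal.ofReal_one, one_mul]

/-- Up to a constant that does not depend on `m`, the expected side probabilities are moments of
the distance distribution. -/
theorem exists_expectedSideProb_eq (k : ℕ) :
    ∃ K : ENNReal, ∀ m, expectedSideProb k m
      = K * ∫⁻ h in Ioo (-1) 1, capPow k m h * ENNReal.ofReal (distDensity k h) := by
  refine ⟨(volume (unitBall (k + 1)))⁻¹ ^ (k + 1) * ∫⁻ b : Fin k → ℝ,
    ENNReal.ofReal ‖graphNormal (Fin.cons 0 b : Fin (k + 1) → ℝ)‖ *
      (ENNReal.ofReal ((1 / ‖graphNormal (Fin.cons 0 b : Fin (k + 1) → ℝ)‖) ^ (k + 2))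
        * graphMoment k 0), fun m => ?_⟩
  have hms := measurable_sideProb k m
  have hB : MeasurableSet (univ.pi fun _ : Fin (k + 1) => unitBall (k + 1)) :=
    MeasurableSet.univ_pi fun _ => measurableSet_unitBall _
  rw [expectedSideProb, pi_cond_unitBall, lintegral_smul_measure, ← lintegral_indicator hB,
    lintegral_points_eq_lintegral_graph (hms.indicator hB), smul_eq_mul, mul_assoc]
  congr 1
  -- For fixed coefficients `v`, the side probability does not depend on the projections.
  have hpt : ∀ (v : Fin (k + 1) → ℝ) (y : Fin (k + 1) → Fin k → ℝ),
      ENNReal.ofReal |(homogMatrix y).det| *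
        (univ.pi fun _ : Fin (k + 1) => unitBall (k + 1)).indicator (sideProb m)
          (fun i => graphPoint v (y i))
      = capPow k m (v 0 / ‖graphNormal v‖) * (ENNReal.ofReal |(homogMatrix y).det| *
        {y : Fin (k + 1) → Fin k → ℝ | ∀ i, graphPoint v (y i) ∈ unitBall (k + 1)}.indicator 1
          y) := by
    intro v y
    by_cases hy : (homogMatrix y).det = 0
    · simp [hy]
    rw [mul_left_comm]
    congr 1
    by_cases hmem : y ∈ {y : Fin (k + 1) → Fin k → ℝ | ∀ i, graphPoint v (y i) ∈ unitBall (k + 1)}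
    · rw [indicator_of_mem (by simpa using hmem), indicator_of_mem hmem,
        sideProb_graphPoint m v hy, Pi.one_apply, mul_one]
    · rw [indicator_of_notMem (by simpa using hmem), indicator_of_notMem hmem, mul_zero]
  have hcap : ∀ h, capPow k m h ≠ ⊤ := fun h =>
    ENNReal.add_ne_top.2 ⟨ENNReal.pow_ne_top ENNReal.ofReal_ne_top,
      ENNReal.pow_ne_top ENNReal.ofReal_ne_top⟩
  simp only [hpt]
  have hG : Measurable fun v : Fin (k + 1) → ℝ =>
      capPow k m (v 0 / ‖graphNormal v‖) * graphMoment k v :=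
    ((measurable_capPow k m).comp ((measurable_pi_apply 0).div
      (measurable_norm_graphNormal k))).mul (measurable_graphMoment k)
  have hinner : ∀ v : Fin (k + 1) → ℝ,
      ∫⁻ y : Fin (k + 1) → Fin k → ℝ, capPow k m (v 0 / ‖graphNormal v‖) *
        (ENNReal.ofReal |(homogMatrix y).det| *
        {y : Fin (k + 1) → Fin k → ℝ | ∀ i, graphPoint v (y i) ∈ unitBall (k + 1)}.indicator 1
          y) = capPow k m (v 0 / ‖graphNormal v‖) * graphMoment k v := fun v => by
    rw [lintegral_const_mul' _ _ (hcap _), graphMoment]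
  simp only [hinner]
  -- Separate the height `v 0` over the origin from the slope `b`.
  have hmp := volume_preserving_piFinSuccAbove (fun _ : Fin (k + 1) => ℝ) 0
  have hwm : Measurable fun b : Fin k → ℝ =>
      ‖graphNormal (Fin.cons 0 b : Fin (k + 1) → ℝ)‖ := by
    refine (measurable_norm_graphNormal k).comp (measurable_pi_lambda _ fun j => ?_)
    refine Fin.cases ?_ (fun j => ?_) j
    · simp only [Fin.cons_zero]
      fun_prop
    · simp only [Fin.cons_succ]
      fun_prop
  have hG' : Measurable fun p : ℝ × (Fin k → ℝ) =>
      capPow k m ((Fin.cons p.1 p.2 : Fin (k + 1) → ℝ) 0 /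
        ‖graphNormal (Fin.cons p.1 p.2 : Fin (k + 1) → ℝ)‖) *
        graphMoment k (Fin.cons p.1 p.2) := by
    refine hG.comp (measurable_pi_lambda _ fun j => ?_)
    refine Fin.cases ?_ (fun j => ?_) j
    · simp only [Fin.cons_zero]
      fun_prop
    · simp only [Fin.cons_succ]
      fun_prop
  have hsplit := hmp.lintegral_comp hG'
  have hcons : ∀ v : Fin (k + 1) → ℝ,
      (Fin.cons (MeasurableEquiv.piFinSuccAbove (fun _ : Fin (k + 1) => ℝ) 0 v).1
        (MeasurableEquiv.piFinSuccAbove (fun _ : Fin (k + 1) => ℝ) 0 v).2 : Fin (k + 1) → ℝ)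
        = v := by
    intro v
    ext j
    refine Fin.cases ?_ (fun j => ?_) j <;>
      simp [MeasurableEquiv.piFinSuccAbove, Fin.insertNthEquiv, Fin.tail]
  simp only [hcons] at hsplit
  rw [hsplit, Measure.volume_eq_prod, lintegral_prod_symm' _ hG', ← lintegral_mul_const]
  swap
  · exact hwm.ennreal_ofReal.mul
      (((hwm.const_div 1).pow_const (k + 2)).ennreal_ofReal.mul_const _)
  refine lintegral_congr fun b => ?_
  simp only [Fin.cons_zero, norm_graphNormal_cons]
  set w := ‖graphNormal (Fin.cons 0 b : Fin (k + 1) → ℝ)‖ with hw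
  have hw0 : 0 < w := norm_graphNormal_pos _
  have hGb := hG'.comp (measurable_id.prodMk (measurable_const (a := b)))
  simp only [Function.comp_def, id, Fin.cons_zero, norm_graphNormal_cons, ← hw] at hGb
  -- For fixed slope, substitute the signed distance `h` from the origin for the height `w h`.
  rw [lintegral_comp_mul_pos hw0 hGb, mul_assoc]
  congr 1
  rw [← lintegral_indicator measurableSet_Ioo, ← lintegral_const_mul]
  swap
  · exact ((measurable_capPow k m).mul
      (continuous_distDensity k).measurable.ennreal_ofReal).indicator measurableSet_Ioo
  refine lintegral_congr_ae ?_
  have hne1 : ∀ᵐ h : ℝ, h ≠ 1 := Measure.ae_ne volume 1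
  have hne2 : ∀ᵐ h : ℝ, h ≠ -1 := Measure.ae_ne volume (-1)
  filter_upwards [hne1, hne2] with h h1 h2
  have hh : w * h / w = h := by field_simp
  have hh' : (Fin.cons (w * h) b : Fin (k + 1) → ℝ) 0 /
      ‖graphNormal (Fin.cons (w * h) b : Fin (k + 1) → ℝ)‖ = h := by
    rw [norm_graphNormal_cons, ← hw, Fin.cons_zero, hh]
  rw [hh]
  by_cases hmem : h ∈ Ioo (-1 : ℝ) 1
  · rw [indicator_of_mem hmem, graphMoment_eq (by rw [hh']; exact abs_lt.2 hmem), hh',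
      norm_graphNormal_cons, ← hw, distDensity, div_eq_mul_one_div, mul_pow,
      ENNReal.ofReal_mul (by positivity)]
    ring
  · rw [indicator_of_notMem hmem, graphMoment_eq_zero, mul_zero, mul_zero]
    rw [hh', lt_abs]
    rw [mem_Ioo, not_and_or, not_lt, not_lt] at hmem
    rcases hmem with h3 | h3
    · right
      linarith [lt_of_le_of_ne h3 h2]
    · left
      exact lt_of_le_of_ne h3 h1.symm

/-! ### Moments of the distance distribution -/

/-- The moments that determine the expected number of facets. -/
noncomputable def capMoment (k m : ℕ) : ℝ :=
  ∫ h in (-1 : ℝ)..1, capCdf k h ^ m * distDensity k h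

theorem continuous_capCdf_pow_mul_distDensity (k m : ℕ) :
    Continuous fun h => capCdf k h ^ m * distDensity k h :=
  ((continuous_capCdf k).pow m).mul (continuous_distDensity k)

theorem distDensity_pos {k : ℕ} {h : ℝ} (hh : h ∈ Ioo (-1 : ℝ) 1) : 0 < distDensity k h := by
  have h' : 0 < √(1 - h ^ 2) := Real.sqrt_pos.2 (by nlinarith [hh.1, hh.2])
  unfold distDensity
  positivity

theorem capMoment_zero_pos (k : ℕ) : 0 < capMoment k 0 := by
  refine intervalIntegral.intervalIntegral_pos_of_pos_on
    ((continuous_capCdf_pow_mul_distDensity k 0).intervalIntegrable _ _) (fun h hh => ?_)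
    (by norm_num)
  simpa using distDensity_pos hh

theorem capMoment_comp_neg (k m : ℕ) :
    ∫ h in (-1 : ℝ)..1, capCdf k (-h) ^ m * distDensity k h = capMoment k m := by
  have h1 : ∀ h, capCdf k (-h) ^ m * distDensity k h
      = (fun h => capCdf k h ^ m * distDensity k h) (-h) := fun h => by
    simp [distDensity]
  rw [intervalIntegral.integral_congr fun h _ => h1 h]
  rw [intervalIntegral.integral_comp_neg fun h => capCdf k h ^ m * distDensity k h, neg_neg,
    capMoment]

theorem capMoment_one (k : ℕ) : 2 * capMoment k 1 = capMoment k 0 := by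
  rw [two_mul]
  nth_rewrite 2 [← capMoment_comp_neg]
  rw [capMoment, capMoment, ← intervalIntegral.integral_add
    ((continuous_capCdf_pow_mul_distDensity k 1).intervalIntegrable _ _)]
  · refine intervalIntegral.integral_congr fun h _ => ?_
    simp only [capCdf_neg]
    ring
  · exact (((((continuous_capCdf k).comp continuous_neg).pow 1).mul
      (continuous_distDensity k))).intervalIntegrable _ _

theorem lintegral_capPow (k m : ℕ) :
    ∫⁻ h in Ioo (-1) 1, capPow k m h * ENNReal.ofReal (distDensity k h)
      = ENNReal.ofReal (2 * capMoment k m) := by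
  have hc1 := continuous_capCdf_pow_mul_distDensity k m
  have hc2 : Continuous fun h => capCdf k (-h) ^ m * distDensity k h :=
    (((continuous_capCdf k).comp continuous_neg).pow m).mul (continuous_distDensity k)
  have h1 : 2 * capMoment k m = ∫ h in Ioo (-1 : ℝ) 1,
      (capCdf k h ^ m * distDensity k h + capCdf k (-h) ^ m * distDensity k h) := by
    rw [← integral_Ioc_eq_integral_Ioo, ← intervalIntegral.integral_of_le (by norm_num),
      intervalIntegral.integral_add (hc1.intervalIntegrable _ _) (hc2.intervalIntegrable _ _),
      capMoment_comp_neg, two_mul]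
    rfl
  rw [h1, ofReal_integral_eq_lintegral_ofReal]
  · refine lintegral_congr fun h => ?_
    rw [capPow, ← ENNReal.ofReal_pow (capCdf_nonneg _ _), ← ENNReal.ofReal_pow (capCdf_nonneg _ _),
      ← ENNReal.ofReal_add (pow_nonneg (capCdf_nonneg _ _) _) (pow_nonneg (capCdf_nonneg _ _) _),
      ← ENNReal.ofReal_mul (add_nonneg (pow_nonneg (capCdf_nonneg _ _) _)
        (pow_nonneg (capCdf_nonneg _ _) _)), add_mul]
  · exact ((hc1.add hc2).integrableOn_Icc (a := -1) (b := 1)).mono_set Ioo_subset_Icc_self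
  · refine Filter.Eventually.of_forall fun h => add_nonneg ?_ ?_ <;>
      exact mul_nonneg (pow_nonneg (capCdf_nonneg _ _) _) (distDensity_nonneg _ _)

theorem expectedSideProb_zero (k : ℕ) : expectedSideProb k 0 = 2 := by
  simp only [expectedSideProb, sideProb, pow_zero, lintegral_const, measure_univ, mul_one]
  norm_num

theorem expectedSideProb_eq (k m : ℕ) :
    expectedSideProb k m = ENNReal.ofReal (2 * capMoment k m / capMoment k 0) := by
  obtain ⟨K, hK⟩ := exists_expectedSideProb_eq k
  have h0 := capMoment_zero_pos k
  -- The constant is found from the case without further points.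
  have h2 := hK 0
  rw [expectedSideProb_zero, lintegral_capPow] at h2
  have hK' : K = ENNReal.ofReal (1 / capMoment k 0) := by
    have hne : ENNReal.ofReal (2 * capMoment k 0) ≠ 0 := (ENNReal.ofReal_pos.2 (by positivity)).ne'
    rw [← ENNReal.mul_left_inj hne ENNReal.ofReal_ne_top, ← h2,
      ← ENNReal.ofReal_mul (by positivity)]
    have : 1 / capMoment k 0 * (2 * capMoment k 0) = 2 := by field_simp
    rw [this]
    simp
  rw [hK m, hK', lintegral_capPow, ← ENNReal.ofReal_mul (by positivity)]
  congr 1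
  ring

/-- The moment inequality behind the monotonicity of the expected number of facets. The weight is
`F' ℓ^k` up to a constant, where `F` is the distribution function of the caps and `ℓ / (1 - F)` is
nondecreasing. Replacing `ℓ / (1 - F)` by its value at the sign change `F = (m + 1) / (m + k + 2)`
decreases the integral and leaves the derivative of `F^(m + 1) (1 - F)^(k + 1)`. -/
theorem integral_capCdf_pow_mul_sub_nonneg (k m : ℕ) :
    0 ≤ ∫ h in (-1 : ℝ)..1, capCdf k h ^ m *
      (capCdf k h - ((m : ℝ) + 1) / ((m : ℝ) + k + 2)) * distDensity k h := by
  set s : ℝ := ((m : ℝ) + 1) / ((m : ℝ) + k + 2) with hs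
  have hden : (0 : ℝ) < (m : ℝ) + k + 2 := by positivity
  have hs0 : 0 < s := by positivity
  have hs1 : s < 1 := by
    rw [hs, div_lt_one hden]
    have : (0 : ℝ) ≤ k := by positivity
    linarith
  obtain ⟨t, ht, hts⟩ := (bijOn_capCdf k).surjOn ⟨hs0.le, hs1.le⟩
  have ht' : t ∈ Ioo (-1 : ℝ) 1 := by
    refine ⟨lt_of_le_of_ne ht.1 ?_, lt_of_le_of_ne ht.2 ?_⟩
    · rintro rfl
      rw [capCdf_neg_one] at hts
      exact hs0.ne hts
    · rintro rfl
      rw [capCdf_one] at hts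
      exact hs1.ne' hts
  set C := (ballVolume (k + 1))⁻¹ * ballVolume k with hC
  have hC0 : 0 < C := inv_ballVolume_mul_ballVolume_pos k
  let ell : ℝ → ℝ := fun h => (1 - h ^ 2) ^ (((k : ℝ) + 1) / 2)
  let q : ℝ → ℝ := fun h => C * (1 - h ^ 2) ^ ((k : ℝ) / 2)
  have hq : Continuous q := continuous_const.mul (continuous_one_sub_sq_rpow (by positivity))
  have hell : Continuous ell := continuous_one_sub_sq_rpow (by positivity)
  have hF := continuous_capCdf k
  have hell0 : ∀ h ∈ Ioo (-1 : ℝ) 1, 0 ≤ ell h := fun h hh =>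
    Real.rpow_nonneg (by nlinarith [hh.1, hh.2]) _
  have hdens : ∀ h ∈ Ioo (-1 : ℝ) 1, distDensity k h = C⁻¹ * (q h * ell h ^ k) := by
    intro h hh
    have hh' : 0 < 1 - h ^ 2 := by nlinarith [hh.1, hh.2]
    simp only [q, ell, distDensity]
    rw [Real.sqrt_eq_rpow, ← pow_mul, ← Real.rpow_mul_natCast hh'.le,
      ← Real.rpow_mul_natCast hh'.le, mul_assoc, ← mul_assoc C⁻¹, inv_mul_cancel₀ hC0.ne', one_mul,
      ← Real.rpow_add hh']
    congr 1
    push_cast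
    ring
  have hderiv : ∀ h ∈ Ioo (-1 : ℝ) 1,
      HasDerivAt (fun h => capCdf k h ^ (m + 1) * (1 - capCdf k h) ^ (k + 1))
        (-((m : ℝ) + k + 2) * (capCdf k h ^ m * (capCdf k h - s) * (1 - capCdf k h) ^ k * q h))
        h := by
    intro h hh
    have hd := hasDerivAt_capCdf (k := k) hh
    rw [capDensity_of_mem (Ioo_subset_Icc_self hh)] at hd
    have h1 := (hd.pow (m + 1)).mul ((hd.const_sub 1).pow (k + 1))
    convert! h1 using 1
    have hsm : ((m : ℝ) + k + 2) * s = (m : ℝ) + 1 := by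
      rw [hs]
      field_simp
    simp only [q, Pi.pow_apply, Nat.add_sub_cancel]
    push_cast
    linear_combination (capCdf k h ^ m * (1 - capCdf k h) ^ k *
      (C * (1 - h ^ 2) ^ ((k : ℝ) / 2))) * hsm
  have hint : Continuous fun h =>
      capCdf k h ^ m * (capCdf k h - s) * (1 - capCdf k h) ^ k * q h := by fun_prop
  have hzero : ∫ h in (-1 : ℝ)..1,
      capCdf k h ^ m * (capCdf k h - s) * (1 - capCdf k h) ^ k * q h = 0 := by
    have h1 := intervalIntegral.integral_eq_sub_of_hasDerivAt_of_le (by norm_num : (-1 : ℝ) ≤ 1)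
      (Continuous.continuousOn (by fun_prop)) hderiv
      ((continuous_const.mul hint).intervalIntegrable _ _)
    rw [capCdf_one, capCdf_neg_one, intervalIntegral.integral_const_mul] at h1
    refine (mul_eq_zero.1 (h1.trans ?_)).resolve_left (neg_ne_zero.2 hden.ne')
    simp
  have hsub : 0 < 1 - s := sub_pos.2 hs1
  -- Pointwise comparison with the weight in which `ℓ / (1 - F)` is frozen at `t`.
  have hmono : ∫ h in (-1 : ℝ)..1, C⁻¹ * ell t ^ k *
      (capCdf k h ^ m * (capCdf k h - s) * (1 - capCdf k h) ^ k * q h)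
      ≤ ∫ h in (-1 : ℝ)..1,
        (1 - s) ^ k * (capCdf k h ^ m * (capCdf k h - s) * distDensity k h) := by
    refine intervalIntegral.integral_mono_on_of_le_Ioo (by norm_num)
      ((continuous_const.mul hint).intervalIntegrable _ _) (Continuous.intervalIntegrable ?_ _ _) ?_
    · have := continuous_distDensity k
      fun_prop
    intro h hh
    have hq0 : 0 ≤ q h := mul_nonneg hC0.le (Real.rpow_nonneg (by nlinarith [hh.1, hh.2]) _)
    have hF0 := capCdf_nonneg k h
    have hF1 := capCdf_le_one k h
    rw [hdens h hh]
    have key : 0 ≤ (capCdf k h - s) *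
        (ell h ^ k * (1 - s) ^ k - ell t ^ k * (1 - capCdf k h) ^ k) := by
      rw [← mul_pow, ← mul_pow]
      rcases le_total h t with hht | hht
      · have h1 := one_sub_sq_rpow_mul_le (k := k) hh.1 hht ht'.2
        rw [hts] at h1
        refine mul_nonneg_of_nonpos_of_nonpos ?_ ?_
        · rw [sub_nonpos, ← hts]
          exact monotone_capCdf k hht
        · rw [sub_nonpos]
          exact pow_le_pow_left₀ (mul_nonneg (hell0 h hh) hsub.le) h1 k
      · have h1 := one_sub_sq_rpow_mul_le (k := k) ht'.1 hht hh.2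
        rw [hts] at h1
        refine mul_nonneg ?_ ?_
        · rw [sub_nonneg, ← hts]
          exact monotone_capCdf k hht
        · rw [sub_nonneg]
          exact pow_le_pow_left₀ (mul_nonneg (hell0 t ht') (sub_nonneg.2 hF1)) h1 k
    have h2 : 0 ≤ C⁻¹ * capCdf k h ^ m * q h * ((capCdf k h - s) *
        (ell h ^ k * (1 - s) ^ k - ell t ^ k * (1 - capCdf k h) ^ k)) := by positivity
    linarith
  rw [intervalIntegral.integral_const_mul, intervalIntegral.integral_const_mul, hzero,
    mul_zero] at hmono
  exact nonneg_of_mul_nonneg_right hmono (pow_pos hsub k)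

theorem capMoment_le (k m : ℕ) :
    ((m : ℝ) + 1) * capMoment k m ≤ ((m : ℝ) + k + 2) * capMoment k (m + 1) := by
  have h := integral_capCdf_pow_mul_sub_nonneg k m
  have hden : (0 : ℝ) < (m : ℝ) + k + 2 := by positivity
  have h1 : ∀ h : ℝ, capCdf k h ^ m * (capCdf k h - ((m : ℝ) + 1) / ((m : ℝ) + k + 2)) *
      distDensity k h = capCdf k h ^ (m + 1) * distDensity k h -
        ((m : ℝ) + 1) / ((m : ℝ) + k + 2) * (capCdf k h ^ m * distDensity k h) := fun h => by ring
  simp only [h1] at h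
  rw [intervalIntegral.integral_sub
    ((continuous_capCdf_pow_mul_distDensity k (m + 1)).intervalIntegrable _ _)
    (((continuous_capCdf_pow_mul_distDensity k m).intervalIntegrable _ _).const_mul _),
    intervalIntegral.integral_const_mul, sub_nonneg, div_mul_eq_mul_div, div_le_iff₀ hden] at h
  rw [capMoment, capMoment]
  linarith

theorem choose_mul_capMoment_le (k m : ℕ) :
    ((m + k + 1).choose (k + 1) : ℝ) * capMoment k m
      ≤ ((m + k + 2).choose (k + 1) : ℝ) * capMoment k (m + 1) := by
  have h1 : (m + k + 2).choose (k + 1) * (m + 1) = (m + k + 1).choose (k + 1) * (m + k + 2) := by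
    have := Nat.choose_mul_succ_eq (m + k + 1) (k + 1)
    rw [show m + k + 1 + 1 - (k + 1) = m + 1 by omega] at this
    linarith
  have h2 : ((m + k + 2).choose (k + 1) : ℝ) * ((m : ℝ) + 1)
      = ((m + k + 1).choose (k + 1) : ℝ) * ((m : ℝ) + k + 2) := by exact_mod_cast h1
  have h3 := mul_le_mul_of_nonneg_left (capMoment_le k m)
    (Nat.cast_nonneg (α := ℝ) ((m + k + 1).choose (k + 1)))
  have hm : (0 : ℝ) < (m : ℝ) + 1 := by positivity
  refine le_of_mul_le_mul_left ?_ hm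
  calc _ = ((m + k + 1).choose (k + 1) : ℝ) * (((m : ℝ) + 1) * capMoment k m) := by ring
    _ ≤ _ := h3
    _ = ((m + k + 1).choose (k + 1) : ℝ) * ((m : ℝ) + k + 2) * capMoment k (m + 1) := by ring
    _ = _ := by rw [← h2]; ring

/-! ### Facets spanned by random points -/

theorem ae_det_homogMatrix_points_ne_zero (k : ℕ) :
    ∀ᵐ x ∂Measure.pi (fun _ : Fin (k + 1) => volume[|unitBall (k + 1)]),
      (homogMatrix fun i j => x i (Fin.succ j)).det ≠ 0 := by
  have hp : MeasurePreserving
      (fun (x : Fin (k + 1) → EuclideanSpace ℝ (Fin (k + 1))) i => WithLp.ofLp (x i))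
      (Measure.pi fun _ => (volume : Measure (EuclideanSpace ℝ (Fin (k + 1))))) volume :=
    volume_preserving_pi fun _ => PiLp.volume_preserving_ofLp (Fin (k + 1))
  have h1 := ((measurePreserving_heights k).comp hp).quasiMeasurePreserving.ae
    (Measure.quasiMeasurePreserving_snd.ae (ae_det_homogMatrix_ne_zero k))
  rw [pi_cond_unitBall]
  exact Measure.ae_smul_measure (ae_restrict_of_ae h1) _

/-- Whether the points `y j` lie strictly below some hyperplane through the points `x i` is decided
by their signs with respect to the hyperplane spanned by the points `x i`. -/
theorem exists_functional_iff_sideFun {k m : ℕ} (hm : 0 < m)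
    {x : Fin (k + 1) → EuclideanSpace ℝ (Fin (k + 1))}
    (hx : (homogMatrix fun i j => x i j.succ).det ≠ 0)
    (y : Fin m → EuclideanSpace ℝ (Fin (k + 1))) :
    (∃ (l : EuclideanSpace ℝ (Fin (k + 1)) →L[ℝ] ℝ) (M : ℝ), (∀ i, l (x i) = M) ∧
        ∀ j, l (y j) < M)
      ↔ (∀ j, 0 < sideFun x (y j)) ∨ ∀ j, sideFun x (y j) < 0 := by
  obtain ⟨v, hv⟩ := exists_eq_graphPoint hx
  set b : Fin (k + 1) → Fin k → ℝ := fun i j => x i j.succ with hb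
  have hside : ∀ z, sideFun x z = (homogMatrix b).det * (inner ℝ z (graphNormal v) - v 0) := by
    intro z
    conv_lhs => rw [hv]
    exact sideFun_graphPoint v b z
  have hxv : ∀ i, inner ℝ (x i) (graphNormal v) = v 0 := by
    intro i
    rw [hv]
    exact inner_graphPoint_graphNormal v _
  have hsign : ((∀ j, 0 < sideFun x (y j)) ∨ ∀ j, sideFun x (y j) < 0)
      ↔ (∀ j, inner ℝ (y j) (graphNormal v) < v 0) ∨
        ∀ j, v 0 < inner ℝ (y j) (graphNormal v) := by
    simp only [hside]
    rcases lt_or_gt_of_ne hx with h | h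
    · simp only [mul_pos_iff, mul_neg_iff, h, h.not_gt, sub_pos, sub_neg, true_and,
        false_and, false_or]
    · rw [or_comm]
      simp only [mul_pos_iff, mul_neg_iff, h, h.not_gt, sub_pos, sub_neg, true_and,
        false_and, or_false]
  rw [hsign]
  constructor
  · rintro ⟨l, M, hlx, hly⟩
    -- Since the projections of the points `x i` span, `l` is a multiple of the normal functional.
    obtain ⟨p, hp⟩ : ∃ p : EuclideanSpace ℝ (Fin (k + 1)), ∀ z, l z = inner ℝ z p :=
      ⟨(InnerProductSpace.toDual ℝ _).symm l, fun z => by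
        rw [real_inner_comm, InnerProductSpace.toDual_symm_apply]⟩
    have hcoef : (homogMatrix b).mulVec (Fin.cons (p 0 * v 0 - M)
        fun j => p 0 * v j.succ + p j.succ) = 0 := by
      ext i
      rw [homogMatrix_mulVec]
      have h1 := hlx i
      have h2 := hxv i
      rw [hp, PiLp.inner_apply, Fin.sum_univ_succ] at h1
      rw [inner_graphNormal] at h2
      simp only [RCLike.inner_apply, conj_trivial] at h1
      simp only [Fin.cons_zero, Fin.cons_succ, add_mul, Finset.sum_add_distrib, Pi.zero_apply,
        mul_assoc, ← Finset.mul_sum, hb]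
      linear_combination h1 - p 0 * h2
    have h0 := Matrix.eq_zero_of_mulVec_eq_zero hx hcoef
    have hM : M = p 0 * v 0 := by
      have := congrFun h0 0
      simp only [Fin.cons_zero, Pi.zero_apply] at this
      linarith
    have hpj : ∀ j : Fin k, p j.succ = -(p 0 * v j.succ) := fun j => by
      have := congrFun h0 j.succ
      simp only [Fin.cons_succ, Pi.zero_apply] at this
      linarith
    have hl : ∀ z, l z = p 0 * inner ℝ z (graphNormal v) := by
      intro z
      rw [hp, inner_graphNormal, PiLp.inner_apply, Fin.sum_univ_succ]
      simp only [RCLike.inner_apply, conj_trivial, hpj]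
      rw [mul_sub, Finset.mul_sum, sub_eq_add_neg, ← Finset.sum_neg_distrib]
      congr 1
      exact Finset.sum_congr rfl fun j _ => by ring
    simp only [hl, hM] at hly
    rcases lt_trichotomy (p 0) 0 with h | h | h
    · exact Or.inr fun j => (mul_lt_mul_left_of_neg h).1 (hly j)
    · have := hly ⟨0, hm⟩
      simp [h] at this
    · exact Or.inl fun j => (mul_lt_mul_iff_right₀ h).1 (hly j)
  · rintro (h | h)
    · refine ⟨innerSL ℝ (graphNormal v), v 0, fun i => ?_, fun j => ?_⟩
      · rw [innerSL_apply_apply, real_inner_comm, hxv]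
      · rw [innerSL_apply_apply, real_inner_comm]
        exact h j
    · refine ⟨-innerSL ℝ (graphNormal v), -v 0, fun i => ?_, fun j => ?_⟩
      · rw [neg_apply, innerSL_apply_apply, real_inner_comm, hxv]
      · rw [neg_apply, innerSL_apply_apply, real_inner_comm, neg_lt_neg_iff]
        exact h j

/-- The configurations in which the points `y j` lie strictly on one side of the hyperplane through
the points `x i`. -/
def oneSided (k m : ℕ) : Set ((Fin (k + 1) → EuclideanSpace ℝ (Fin (k + 1))) ×
    (Fin m → EuclideanSpace ℝ (Fin (k + 1)))) :=
  {p | (∀ j, 0 < sideFun p.1 (p.2 j)) ∨ ∀ j, sideFun p.1 (p.2 j) < 0}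

theorem measurableSet_oneSided (k m : ℕ) : MeasurableSet (oneSided k m) := by
  have hc : ∀ j : Fin m, Measurable fun p : (Fin (k + 1) → EuclideanSpace ℝ (Fin (k + 1))) ×
      (Fin m → EuclideanSpace ℝ (Fin (k + 1))) => sideFun p.1 (p.2 j) := fun j =>
    ((continuous_sideFun k).comp
      (continuous_fst.prodMk ((continuous_apply j).comp continuous_snd))).measurable
  have h : oneSided k m = (⋂ j, {p | 0 < sideFun p.1 (p.2 j)}) ∪
      ⋂ j, {p | sideFun p.1 (p.2 j) < 0} := by
    ext p
    simp [oneSided]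
  rw [h]
  exact (MeasurableSet.iInter fun j => measurableSet_lt measurable_const (hc j)).union
    (MeasurableSet.iInter fun j => measurableSet_lt (hc j) measurable_const)

theorem measure_oneSided (k : ℕ) {m : ℕ} (hm : 0 < m) :
    ((Measure.pi fun _ : Fin (k + 1) => volume[|unitBall (k + 1)]).prod
      (Measure.pi fun _ : Fin m => volume[|unitBall (k + 1)])) (oneSided k m)
      = expectedSideProb k m := by
  rw [Measure.prod_apply (measurableSet_oneSided k m), expectedSideProb]
  refine lintegral_congr fun x => ?_
  have h1 : Prod.mk x ⁻¹' oneSided k m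
      = (univ.pi fun _ : Fin m => {z | 0 < sideFun x z}) ∪
        univ.pi fun _ : Fin m => {z | sideFun x z < 0} := by
    ext y
    simp [oneSided]
  have hdisj : Disjoint (univ.pi fun _ : Fin m => {z | 0 < sideFun x z})
      (univ.pi fun _ : Fin m => {z | sideFun x z < 0}) := by
    rw [disjoint_left]
    intro y hy hy'
    exact lt_asymm (a := sideFun x (y ⟨0, hm⟩)) (b := 0) (hy' ⟨0, hm⟩ trivial)
      (hy ⟨0, hm⟩ trivial)
  have hc : Continuous (sideFun x) :=
    (continuous_sideFun k).comp (continuous_const.prodMk continuous_id)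
  rw [h1, measure_union hdisj (MeasurableSet.univ_pi fun _ =>
    measurableSet_lt hc.measurable measurable_const), Measure.pi_pi, Measure.pi_pi]
  simp [sideProb]

theorem aemeasurable_of_isUniform {Ω : Type*} [MeasurableSpace Ω] {P : Measure Ω} {k : ℕ}
    {X : ℕ → Ω → EuclideanSpace ℝ (Fin (k + 1))}
    (hU : ∀ i, pdf.IsUniform (X i) (unitBall (k + 1)) P volume) (i : ℕ) : AEMeasurable (X i) P :=
  (hU i).aemeasurable (volume_unitBall_ne_zero _) (volume_unitBall_ne_top _)

section Random

variable {Ω : Type*} [MeasurableSpace Ω] {P : Measure Ω} [IsProbabilityMeasure P] {k : ℕ}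
  {X : ℕ → Ω → EuclideanSpace ℝ (Fin (k + 1))}

theorem map_points_eq_pi (hX : iIndepFun X P)
    (hU : ∀ i, pdf.IsUniform (X i) (unitBall (k + 1)) P volume) {ι : Type*} [Fintype ι]
    {σ : ι → ℕ} (hσ : Function.Injective σ) :
    P.map (fun ω i => X (σ i) ω) = Measure.pi fun _ => volume[|unitBall (k + 1)] := by
  have h := (iIndepFun_iff_map_fun_eq_pi_map
    fun i => aemeasurable_of_isUniform hU (σ i)).1 (hX.precomp hσ)
  rw [h]
  congr 1
  ext1 i
  exact hU (σ i)

theorem ae_inGeneralPosition (hX : iIndepFun X P)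
    (hU : ∀ i, pdf.IsUniform (X i) (unitBall (k + 1)) P volume) :
    ∀ᵐ ω ∂P, InGeneralPosition (k + 1) fun i => X i ω := by
  refine ae_all_iff.2 fun σ => ?_
  by_cases hσ : Function.Injective σ
  swap
  · exact Filter.Eventually.of_forall fun ω h => absurd h hσ
  have hae := ae_affineIndependent (μ := volume[|unitBall (k + 1)]) (m := k + 1 + 1)
    (addHaar_affineSubspace_cond volume (unitBall (k + 1))) (by simp)
  rw [← map_points_eq_pi hX hU hσ] at hae
  filter_upwards [ae_of_ae_map (aemeasurable_pi_lambda _ fun i =>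
    aemeasurable_of_isUniform hU (σ i)) hae] with ω hω _
  exact hω

/-- The event that `k + 1` of the points span a facet has the expected side probability. -/
theorem integrable_and_integral_isFacetIndex (hX : iIndepFun X P)
    (hU : ∀ i, pdf.IsUniform (X i) (unitBall (k + 1)) P volume) {m : ℕ} (hm : 0 < m)
    {I : Finset ℕ} (hI : I ∈ (Finset.range (m + (k + 1))).powersetCard (k + 1)) :
    Integrable ({ω | IsFacetIndex (fun i => X i ω) (m + (k + 1)) I}.indicator
        (1 : Ω → ℝ)) P ∧
      ∫ ω, {ω | IsFacetIndex (fun i => X i ω) (m + (k + 1)) I}.indicator (1 : Ω → ℝ) ω ∂P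
        = 2 * capMoment k m / capMoment k 0 := by
  obtain ⟨hIsub, hIcard⟩ := Finset.mem_powersetCard.1 hI
  have hJcard : (Finset.range (m + (k + 1)) \ I).card = m := by
    rw [Finset.card_sdiff_of_subset hIsub, hIcard, Finset.card_range]
    omega
  set J := Finset.range (m + (k + 1)) \ I
  let σ : Fin (k + 1) ⊕ Fin m → ℕ := Sum.elim (I.orderEmbOfFin hIcard) (J.orderEmbOfFin hJcard)
  have hσ : Function.Injective σ := by
    refine Function.Injective.sumElim (I.orderEmbOfFin hIcard).injective
      (J.orderEmbOfFin hJcard).injective fun i j hij => ?_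
    have h1 := I.orderEmbOfFin_mem hIcard i
    have h2 := J.orderEmbOfFin_mem hJcard j
    rw [← hij] at h2
    exact (Finset.mem_sdiff.1 h2).2 h1
  let Y : Ω → (Fin (k + 1) → EuclideanSpace ℝ (Fin (k + 1))) ×
      (Fin m → EuclideanSpace ℝ (Fin (k + 1))) := fun ω =>
    (fun i => X (σ (Sum.inl i)) ω, fun j => X (σ (Sum.inr j)) ω)
  have hXm := aemeasurable_of_isUniform hU
  have hYm : AEMeasurable Y P :=
    (aemeasurable_pi_lambda _ fun i => hXm _).prodMk (aemeasurable_pi_lambda _ fun j => hXm _)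
  have hmap : P.map Y = (Measure.pi fun _ : Fin (k + 1) => volume[|unitBall (k + 1)]).prod
      (Measure.pi fun _ : Fin m => volume[|unitBall (k + 1)]) := by
    have h1 := measurePreserving_sumPiEquivProdPi
      (X := fun _ : Fin (k + 1) ⊕ Fin m => EuclideanSpace ℝ (Fin (k + 1)))
      (fun _ => volume[|unitBall (k + 1)])
    rw [← h1.map_eq, ← map_points_eq_pi hX hU hσ, AEMeasurable.map_map_of_aemeasurable
      h1.measurable.aemeasurable (aemeasurable_pi_lambda _ fun i => hXm _)]
    rfl
  have hdet : ∀ᵐ ω ∂P, (homogMatrix fun i j => X (σ (Sum.inl i)) ω (Fin.succ j)).det ≠ 0 := by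
    have h1 := ae_det_homogMatrix_points_ne_zero k
    rw [← map_points_eq_pi hX hU (hσ.comp Sum.inl_injective)] at h1
    exact ae_of_ae_map (aemeasurable_pi_lambda _ fun i => hXm _) h1
  have hae : ({ω | IsFacetIndex (fun i => X i ω) (m + (k + 1)) I}.indicator (1 : Ω → ℝ))
      =ᵐ[P] fun ω => (oneSided k m).indicator (fun _ => (1 : ℝ)) (Y ω) := by
    filter_upwards [hdet] with ω hω
    have hiff : IsFacetIndex (fun i => X i ω) (m + (k + 1)) I ↔ Y ω ∈ oneSided k m := by
      refine Iff.trans ?_ (exists_functional_iff_sideFun hm hω fun j => X (σ (Sum.inr j)) ω)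
      refine exists_congr fun l => exists_congr fun M => and_congr ?_ ?_
      · constructor
        · exact fun h i => h _ (I.orderEmbOfFin_mem hIcard i)
        · intro h i hi
          have : i ∈ range (I.orderEmbOfFin hIcard) := by
            rw [Finset.range_orderEmbOfFin]
            exact hi
          obtain ⟨a, rfl⟩ := this
          exact h a
      · constructor
        · intro h j
          have h1 := J.orderEmbOfFin_mem hJcard j
          have h2 := Finset.mem_sdiff.1 h1
          exact h _ (Finset.mem_range.1 h2.1) h2.2
        · intro h i hi hiI
          have : i ∈ range (J.orderEmbOfFin hJcard) := by
            rw [Finset.range_orderEmbOfFin]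
            exact Finset.mem_sdiff.2 ⟨Finset.mem_range.2 hi, hiI⟩
          obtain ⟨a, rfl⟩ := this
          exact h a
    classical
    exact if_congr hiff rfl rfl
  have hS : Integrable ((oneSided k m).indicator (fun _ => (1 : ℝ))) (P.map Y) := by
    rw [hmap]
    exact (integrable_const (1 : ℝ)).indicator (measurableSet_oneSided k m)
  refine ⟨(hS.comp_aemeasurable hYm).congr hae.symm, ?_⟩
  rw [integral_congr_ae hae, ← integral_map hYm hS.aestronglyMeasurable,
    integral_indicator_const 1 (measurableSet_oneSided k m), Measure.real, hmap,
    measure_oneSided k hm, expectedSideProb_eq, ENNReal.toReal_ofReal, smul_eq_mul, mul_one]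
  refine div_nonneg (mul_nonneg zero_le_two ?_) (capMoment_zero_pos k).le
  exact intervalIntegral.integral_nonneg (by norm_num) fun h _ =>
    mul_nonneg (pow_nonneg (capCdf_nonneg k h) m) (distDensity_nonneg k h)

theorem ae_numFaces_eq_of_lt (hX : iIndepFun X P)
    (hU : ∀ i, pdf.IsUniform (X i) (unitBall (k + 1)) P volume) {n : ℕ} (hn : n < k + 1) :
    ∀ᵐ ω ∂P, (numFaces (randomPolytope X n ω) k : ℝ) = 0 := by
  filter_upwards [ae_inGeneralPosition hX hU] with ω hω
  rw [randomPolytope, numFaces_convexHull_eq_card hω,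
    Finset.powersetCard_eq_empty.2 (by simpa using hn)]
  simp

theorem ae_numFaces_eq_one (hX : iIndepFun X P)
    (hU : ∀ i, pdf.IsUniform (X i) (unitBall (k + 1)) P volume) :
    ∀ᵐ ω ∂P, (numFaces (randomPolytope X (k + 1) ω) k : ℝ) = 1 := by
  filter_upwards [ae_inGeneralPosition hX hU] with ω hω
  have hself : (Finset.range (k + 1)).powersetCard (k + 1) = {Finset.range (k + 1)} := by
    conv_lhs => rw [← Finset.card_range (k + 1), Finset.card_range (k + 1)]
    have := Finset.powersetCard_self (Finset.range (k + 1))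
    rwa [Finset.card_range] at this
  -- The zero functional shows that the simplex is a face of itself.
  have hfacet : IsFacetIndex (fun i => X i ω) (k + 1) (Finset.range (k + 1)) :=
    ⟨0, 0, fun _ _ => rfl, fun i hi hi' => absurd (Finset.mem_range.2 hi) hi'⟩
  rw [randomPolytope, numFaces_convexHull_eq_card hω, hself, Finset.filter_singleton,
    if_pos hfacet]
  simp

theorem integrable_and_integral_numFaces (hX : iIndepFun X P)
    (hU : ∀ i, pdf.IsUniform (X i) (unitBall (k + 1)) P volume) {m : ℕ} (hm : 0 < m) :
    Integrable (fun ω => (numFaces (randomPolytope X (m + (k + 1)) ω) k : ℝ)) P ∧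
      ∫ ω, (numFaces (randomPolytope X (m + (k + 1)) ω) k : ℝ) ∂P
        = (m + (k + 1)).choose (k + 1) * (2 * capMoment k m / capMoment k 0) := by
  have hae : (fun ω => (numFaces (randomPolytope X (m + (k + 1)) ω) k : ℝ)) =ᵐ[P]
      fun ω => ∑ I ∈ (Finset.range (m + (k + 1))).powersetCard (k + 1),
        {ω | IsFacetIndex (fun i => X i ω) (m + (k + 1)) I}.indicator (1 : Ω → ℝ) ω := by
    filter_upwards [ae_inGeneralPosition hX hU] with ω hω
    classical
    rw [randomPolytope, numFaces_convexHull_eq_card hω, Finset.card_filter]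
    push_cast
    refine Finset.sum_congr rfl fun I _ => ?_
    by_cases h : IsFacetIndex (fun i => X i ω) (m + (k + 1)) I <;> simp [h]
  have hint := fun I hI => integrable_and_integral_isFacetIndex hX hU hm (I := I) hI
  refine ⟨(integrable_finsetSum _ fun I hI => (hint I hI).1).congr hae.symm, ?_⟩
  rw [integral_congr_ae hae, integral_finsetSum _ fun I hI => (hint I hI).1,
    Finset.sum_congr rfl fun I hI => (hint I hI).2]
  simp

theorem integrable_numFaces (hX : iIndepFun X P)
    (hU : ∀ i, pdf.IsUniform (X i) (unitBall (k + 1)) P volume) (n : ℕ) :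
    Integrable (fun ω => (numFaces (randomPolytope X n ω) k : ℝ)) P := by
  rcases lt_trichotomy n (k + 1) with hn | rfl | hn
  · exact (integrable_zero _ _ _).congr
      ((ae_numFaces_eq_of_lt hX hU hn).mono fun ω h => h.symm)
  · exact (integrable_const 1).congr ((ae_numFaces_eq_one hX hU).mono fun ω h => h.symm)
  · obtain ⟨m, rfl⟩ : ∃ m, n = m + (k + 1) := ⟨n - (k + 1), by omega⟩
    exact (integrable_and_integral_numFaces hX hU (by omega)).1

theorem monotone_integral_numFaces (hX : iIndepFun X P)
    (hU : ∀ i, pdf.IsUniform (X i) (unitBall (k + 1)) P volume) :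
    Monotone fun n => ∫ ω, (numFaces (randomPolytope X n ω) k : ℝ) ∂P := by
  refine monotone_nat_of_le_succ fun n => ?_
  have h0 := capMoment_zero_pos k
  rcases lt_trichotomy n (k + 1) with hn | rfl | hn
  · rw [integral_eq_zero_of_ae (ae_numFaces_eq_of_lt hX hU hn)]
    exact integral_nonneg fun ω => Nat.cast_nonneg _
  · have h1 := (integrable_and_integral_numFaces hX hU one_pos).2
    rw [add_comm 1 (k + 1)] at h1
    rw [integral_congr_ae (ae_numFaces_eq_one hX hU), h1, capMoment_one, div_self h0.ne',
      Nat.choose_succ_self_right]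
    simp only [integral_const, probReal_univ, smul_eq_mul, mul_one]
    push_cast
    linarith [Nat.cast_nonneg (α := ℝ) k]
  · obtain ⟨m, rfl⟩ : ∃ m, n = m + (k + 1) := ⟨n - (k + 1), by omega⟩
    rw [(integrable_and_integral_numFaces hX hU (by omega)).2,
      show m + (k + 1) + 1 = m + 1 + (k + 1) by ring,
      (integrable_and_integral_numFaces hX hU (by omega)).2, mul_div_assoc', mul_div_assoc']
    refine div_le_div_of_nonneg_right ?_ h0.le
    have h := choose_mul_capMoment_le k m
    rw [show m + 1 + (k + 1) = m + k + 2 by ring, ← add_assoc m k 1]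
    linarith

end Random

theorem mainTheorem2 (d : ℕ) (hd : 1 ≤ d) :
    -- the expected number of facets is nondecreasing
    (∀ (Ω : Type*) [MeasurableSpace Ω] (P : Measure Ω) [IsProbabilityMeasure P]
        (X : ℕ → Ω → EuclideanSpace ℝ (Fin d)),
      iIndepFun X P → (∀ i, pdf.IsUniform (X i) (unitBall d) P volume) →
        (∀ n, Integrable (fun ω => (numFaces (randomPolytope X n ω) (d - 1) : ℝ)) P) ∧
        Monotone (fun n => ∫ ω, (numFaces (randomPolytope X n ω) (d - 1) : ℝ) ∂P)) ∧
    (2 ≤ d →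
      -- the section function and its distribution function
      (∀ u : EuclideanSpace ℝ (Fin d), ‖u‖ = 1 →
        (∀ t, sectionDensity u t
          = (ballVolume d)⁻¹ * (μHE[d - 1]).real (hyperplane u t ∩ unitBall d)) ∧
        (∀ t ∈ Icc (-1 : ℝ) 1, sectionDensity u t
          = (ballVolume d)⁻¹ * ballVolume (d - 1) * (1 - t ^ 2) ^ (((d : ℝ) - 1) / 2)) ∧
        StrictMonoOn (sectionCdf u) (Icc (-1) 1) ∧
        BijOn (sectionCdf u) (Icc (-1) 1) (Icc 0 1)) ∧
      -- its power with exponent 1/(d-1) is proportional to √(1 - t²) and concave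
      (∃ a : ℝ, 0 < a ∧ ∀ u : EuclideanSpace ℝ (Fin d), ‖u‖ = 1 →
        (∀ t ∈ Icc (-1 : ℝ) 1,
          sectionDensity u t ^ (1 / ((d : ℝ) - 1)) = a * Real.sqrt (1 - t ^ 2)) ∧
        ConcaveOn ℝ (Icc (-1) 1) fun t => sectionDensity u t ^ (1 / ((d : ℝ) - 1))) ∧
      -- the expected simplex volume is a constant times the section function
      (∃ C : ℝ, 0 < C ∧ ∀ u : EuclideanSpace ℝ (Fin d), ‖u‖ = 1 → ∀ t ∈ Ioo (-1 : ℝ) 1,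
        expectedSimplexVolume u t = C * sectionDensity u t) ∧
      -- the form of `L` and its concavity
      (∃ c : ℝ, 0 < c ∧ ∀ u : EuclideanSpace ℝ (Fin d), ‖u‖ = 1 →
        (∀ s ∈ Icc (0 : ℝ) 1, sectionProfile u s
          = c * sectionDensity u (sectionQuantile u s) ^ ((d : ℝ) / ((d : ℝ) - 1))) ∧
        ConcaveOn ℝ (Icc 0 1) (sectionProfile u))) := by
  obtain ⟨k, rfl⟩ : ∃ k, d = k + 1 := ⟨d - 1, by omega⟩
  simp only [Nat.add_sub_cancel, Nat.cast_add, Nat.cast_one, add_sub_cancel_right]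
  refine ⟨fun Ω _ P _ X hX hU =>
    ⟨integrable_numFaces hX hU, monotone_integral_numFaces hX hU⟩, fun hk => ?_⟩
  replace hk : 1 ≤ k := by omega
  refine ⟨fun u hu => ⟨sectionDensity_eq_real u, fun t ht => sectionDensity_of_mem hu ht, ?_, ?_⟩,
    ⟨((ballVolume (k + 1))⁻¹ * ballVolume k) ^ (1 / (k : ℝ)),
      Real.rpow_pos_of_pos (inv_ballVolume_mul_ballVolume_pos k) _, fun u hu =>
      ⟨fun t ht => sectionDensity_rpow_inv hk hu ht, concaveOn_sectionDensity_rpow_inv hk hu⟩⟩,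
    ⟨ballSimplexVolume k / ((ballVolume (k + 1))⁻¹ * ballVolume k),
      div_pos (ballSimplexVolume_pos k) (inv_ballVolume_mul_ballVolume_pos k),
      fun u hu t ht => expectedSimplexVolume_eq_mul_sectionDensity hu ht⟩,
    ⟨(ballSimplexVolume k / ((ballVolume (k + 1))⁻¹ * ballVolume k)) ^ (1 / (k : ℝ)),
      Real.rpow_pos_of_pos
        (div_pos (ballSimplexVolume_pos k) (inv_ballVolume_mul_ballVolume_pos k)) _,
      fun u hu => ⟨fun s hs => sectionProfile_eq hk hu hs, concaveOn_sectionProfile hk hu⟩⟩⟩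
  · rw [show sectionCdf u = capCdf k from funext (sectionCdf_eq_capCdf hu)]
    exact strictMonoOn_capCdf k
  · rw [show sectionCdf u = capCdf k from funext (sectionCdf_eq_capCdf hu)]
    exact bijOn_capCdf k
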